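/- Assume the generalized Riemann hypothesis for Dirichlet $L$-functions: for every Dirichlet character $\chi$ of any modulus (including the trivial character modulo $1$), every zero of $L(s,\chi)$ with $0<\operatorname{Re}(s)<1$ satisfies $\operatorname{Re}(s)=1/2$. Let $q$ be a prime power and let $E$ be an elliptic curve over $\mathbb{F}_q$. Put $t_E=q+1-\#E(\mathbb{F}_q)$ and assume that $t_E^2-4q$ is not a perfect square (in particular, it is nonzero). A prime $\ell$ with $(\ell,q)=1$ is called an Elkies prime of $E$ if $\left(\frac{t_E^2-4q}{\ell}\right)=1$, where the symbol is the Legendre symbol for odd $\ell$ and the Kronecker symbol for $\ell=2$. Let $N_E(X)$ be the number of Elkies primes $\ell\le X$, and $\pi(X)$ the number of primes $\ell\le X$. Then for all real $X\ge 2$ $$ N_E(X)=\frac{\pi(X)}{2}+O\left(\frac{\sqrt{X}\,(\log qX)^2}{\log X}\right), $$ where the implied constant is absolute (independent of $q$, $E$ and $X$). In particular, for each fixed such $E$, $N_E(X)\sim \pi(X)/2$ as $X\to\infty$. -/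

import Mathlib

namespace ElkiesPrimes

/-- The generalized Riemann hypothesis for Dirichlet `L`-functions: every zero of every `L(s, χ)`
in the open critical strip lies on the critical line. The characters of modulus `1` are included,
so that this contains the Riemann hypothesis. -/
def GRH : Prop :=
  ∀ (m : ℕ) [NeZero m] (χ : DirichletCharacter ℂ m) (s : ℂ),
    DirichletCharacter.LFunction χ s = 0 → 0 < s.re → s.re < 1 → s.re = 1 / 2

/-- The trace of Frobenius `t_E = q + 1 - #E(𝔽_q)` of a curve `E` over the finite field `F` with
`q` elements; `#E(𝔽_q)` counts the affine points and the point at infinity. -/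
noncomputable def trace {F : Type*} [Field F] (E : WeierstrassCurve F) : ℤ :=
  (Nat.card F : ℤ) + 1 - (Nat.card E.toAffine.Point : ℤ)

/-- The discriminant `t_E ^ 2 - 4 q` of the characteristic polynomial of Frobenius. -/
noncomputable def frobDisc {F : Type*} [Field F] (E : WeierstrassCurve F) : ℤ :=
  trace E ^ 2 - 4 * (Nat.card F : ℤ)

/-- The symbol `(D / ℓ)` at a prime `ℓ`: the Legendre symbol for odd `ℓ`, and the Kronecker symbol
for `ℓ = 2` (`0` if `D` is even, `1` if `D ≡ ±1 mod 8`, `-1` if `D ≡ ±3 mod 8`). -/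
def symbol (D : ℤ) (ℓ : ℕ) [Fact ℓ.Prime] : ℤ :=
  if ℓ = 2 then ZMod.χ₈ (D : ZMod 8) else legendreSym ℓ D

/-- `ℓ` is an Elkies prime of `E`: a prime with `(ℓ, q) = 1` and `((t_E ^ 2 - 4 q) / ℓ) = 1`. -/
def IsElkiesPrime {F : Type*} [Field F] (E : WeierstrassCurve F) (ℓ : ℕ) : Prop :=
  ∃ h : ℓ.Prime, ℓ.Coprime (Nat.card F) ∧
    haveI : Fact ℓ.Prime := ⟨h⟩
    symbol (frobDisc E) ℓ = 1

open Classical in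
/-- `N_E(X)`, the number of Elkies primes of `E` up to `X`. -/
noncomputable def elkiesCount {F : Type*} [Field F] (E : WeierstrassCurve F) (X : ℝ) : ℕ :=
  ((Finset.range (⌊X⌋₊ + 1)).filter fun ℓ => IsElkiesPrime E ℓ).card

end ElkiesPrimes

/-! ### Zeros and logarithmic derivatives of entire functions on discs. -/

section

open Complex Metric Set

namespace ElkiesPrimes

/-! Write `D` for the Frobenius discriminant. Away from the primes dividing `4 D q`, the indicator
of an Elkies prime is `(1 + χ(ℓ)) / 2`, with `χ` the Jacobi character of modulus `m = 4 |D|`. The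
number of exceptional primes is `O(log q)`, since `|D|` is bounded by a power of `q`. As `D` is not
a square, `χ` is nontrivial (`jacobiCharacter_ne_one`), so everything rests on the GRH bound for
prime sums of a nontrivial character, `norm_sum_prime_character_le`, with `log m = O(log q)`.

For that bound, `χ Λ` is summed against a trapezoid falling from `1` to `0` on `[x, x + √x]`, and
Mellin inversion gives an integral of `L'/L` on the line `Re s = 1/2 + δ`, `δ = 1 / (2 log x)`.
There `x ^ δ` is constant, and the transform of the trapezoid is `O(√x (1 + |t|) ^ (-1 - δ))`. The
pointwise estimate `L'/L = O(log(m(|t|+2)) / δ)` would cost one logarithm too many. Two observations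
save it.

Near height `t₀`, `L'/L` is a sum of `1 / (s - ρ)` over `O(log(m(|t₀|+2)))` zeros, up to an error of
that size. Under GRH the real part of each term is a positive Poisson kernel of total mass at most
`π`, so `|Re L'/L|` has mean `O(log(m(|t₀|+2)))` uniformly in `δ` (`integral_abs_re_logDeriv_le`).

Moreover `L'/L` is twice its real part minus its conjugate. On the line, the conjugate agrees with a
function holomorphic to the left, namely the conjugate of `L'/L` at the reflected point `1 + 2δ -
conj s`. Its contour moves to `Re s = δ`, where `x ^ s` is bounded and `L'/L` is evaluated at real
part `1 + δ`; only powers of logarithms remain (`norm_integral_conj_logDeriv_le`).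

Removing the ramp, the prime powers and the weight `log p` costs nothing of larger order. The
asymptotic equivalence then needs only Chebyshev's lower bound for `π`. -/

/-- The product of the numerators of the Blaschke factors of radius `R` at the points of `Z`. -/
noncomputable def blaschkeNumerator (R : ℝ) (Z : Multiset ℂ) (z : ℂ) : ℂ :=
  (Z.map fun ρ => ((R : ℂ) ^ 2 - (starRingEnd ℂ) ρ * z) / R).prod

lemma differentiable_blaschkeNumerator (R : ℝ) (Z : Multiset ℂ) :
    Differentiable ℂ (blaschkeNumerator R Z) := by
  unfold blaschkeNumerator
  induction Z using Multiset.induction_on with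
  | empty => simp
  | cons a s ih =>
    simp only [Multiset.map_cons, Multiset.prod_cons]
    exact Differentiable.fun_mul (by fun_prop) ih

/-- On the circle `R² = conj z * z`, so each factor is `conj (z - ρ) * z / R`, of modulus `|z - ρ|`.
-/
lemma norm_blaschkeNumerator_of_norm_eq {R : ℝ} (hR : 0 < R) (Z : Multiset ℂ) {z : ℂ}
    (hz : ‖z‖ = R) : ‖blaschkeNumerator R Z z‖ = ‖(Z.map (z - ·)).prod‖ := by
  unfold blaschkeNumerator
  induction Z using Multiset.induction_on with
  | empty => simp
  | cons a s ih =>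
    simp only [Multiset.map_cons, Multiset.prod_cons, norm_mul, ih]
    congr 1
    have h1 : (R : ℂ) ^ 2 = (starRingEnd ℂ) z * z := by
      rw [mul_comm, Complex.mul_conj, Complex.normSq_eq_norm_sq, hz]; push_cast; rfl
    rw [h1, ← sub_mul, ← map_sub, norm_div, norm_mul, Complex.norm_conj, hz, norm_real,
      Real.norm_of_nonneg hR.le]
    field_simp

lemma blaschkeNumerator_zero {R : ℝ} (hR : 0 < R) (Z : Multiset ℂ) :
    blaschkeNumerator R Z 0 = (R : ℂ) ^ Z.card := by
  have : (R : ℂ) ≠ 0 := by exact_mod_cast hR.ne'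
  simp [blaschkeNumerator, pow_two, this]

lemma blaschkeNumerator_factor_ne_zero {R r : ℝ} (hr : 0 ≤ r) {ρ z : ℂ}
    (hρ : ‖ρ‖ ≤ r) (hz : ‖z‖ ≤ r) :
    R ^ 2 - r ^ 2 ≤ ‖(R : ℂ) ^ 2 - (starRingEnd ℂ) ρ * z‖ := by
  have h1 := norm_sub_norm_le ((R : ℂ) ^ 2) ((starRingEnd ℂ) ρ * z)
  have h2 : ‖(starRingEnd ℂ) ρ * z‖ ≤ r * r := by
    rw [norm_mul, Complex.norm_conj]; gcongr
  have h3 : ‖(R : ℂ) ^ 2‖ = R ^ 2 := by simp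
  nlinarith

/-- Multiplying the zero-free part of `g` by the numerators of Blaschke factors does not increase
the bound of `g` on the disc. -/
lemma norm_blaschkeNumerator_mul_le {R M : ℝ} (hR : 0 < R) {g h : ℂ → ℂ} {Z : Multiset ℂ}
    (hh : Differentiable ℂ h) (hM : ∀ z ∈ closedBall (0 : ℂ) R, ‖g z‖ ≤ M)
    (hfac : ∀ z, g z = (Z.map (z - ·)).prod * h z) {z : ℂ} (hz : z ∈ closedBall (0 : ℂ) R) :
    ‖blaschkeNumerator R Z z * h z‖ ≤ M := by
  have hd : Differentiable ℂ fun z => blaschkeNumerator R Z z * h z :=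
    (differentiable_blaschkeNumerator R Z).fun_mul hh
  refine Complex.norm_le_of_forall_mem_frontier_norm_le (U := ball (0 : ℂ) R)
    (f := fun z => blaschkeNumerator R Z z * h z) isBounded_ball hd.diffContOnCl ?_ ?_
  · intro w hw
    rw [frontier_ball _ hR.ne', mem_sphere_zero_iff_norm] at hw
    rw [norm_mul, norm_blaschkeNumerator_of_norm_eq hR Z hw, ← norm_mul, ← hfac]
    exact hM w (by simp [hw])
  · rwa [closure_ball _ hR.ne']

lemma norm_prod_neg_le {r : ℝ} (Z : Multiset ℂ) (hZ : ∀ ρ ∈ Z, ‖ρ‖ ≤ r) :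
    ‖(Z.map ((0 : ℂ) - ·)).prod‖ ≤ r ^ Z.card := by
  induction Z using Multiset.induction_on with
  | empty => simp
  | cons a s ih =>
    simp only [Multiset.map_cons, Multiset.prod_cons, norm_mul, Multiset.card_cons, pow_succ']
    have ha := hZ a (by simp)
    have := ih fun ρ hρ => hZ ρ (by simp [hρ])
    have h0 : 0 ≤ r := (norm_nonneg _).trans ha
    gcongr
    simpa using ha

/-- Jensen's inequality for the number of zeros in a disc. -/
lemma pow_card_mul_le {R r : ℝ} (hr : 0 < r) (hR : 0 < R) {g h : ℂ → ℂ} {Z : Multiset ℂ}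
    (hfac : ∀ z, g z = (Z.map (z - ·)).prod * h z) (hZ : ∀ ρ ∈ Z, ‖ρ‖ ≤ r) :
    (R / r) ^ Z.card * ‖g 0‖ ≤ ‖blaschkeNumerator R Z 0 * h 0‖ := by
  rw [blaschkeNumerator_zero hR, norm_mul, hfac 0, norm_mul, norm_pow, norm_real,
    Real.norm_of_nonneg hR.le]
  have := norm_prod_neg_le Z hZ
  calc (R / r) ^ Z.card * (‖(Z.map ((0 : ℂ) - ·)).prod‖ * ‖h 0‖)
      ≤ (R / r) ^ Z.card * (r ^ Z.card * ‖h 0‖) := by gcongr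
    _ = R ^ Z.card * ‖h 0‖ := by rw [div_pow]; field_simp

/-- A zero-free bounded holomorphic function has a controlled logarithmic derivative. -/
lemma norm_deriv_div_le {G : ℂ → ℂ} {M : ℝ} (hG : Differentiable ℂ G)
    (hne : ∀ z ∈ ball (0 : ℂ) (17 / 10), G z ≠ 0)
    (hM : ∀ z ∈ ball (0 : ℂ) (17 / 10), ‖G z‖ ≤ M) {z : ℂ} (hz : ‖z‖ ≤ 8 / 5) :
    ‖deriv G z / G z‖ ≤ 2640 * (Real.log (M / ‖G 0‖) + 1) := by
  have h0 : (0 : ℂ) ∈ ball (0 : ℂ) (17 / 10) := by simp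
  have hG0 := hne 0 h0
  have hG0' : 0 < ‖G 0‖ := norm_pos_iff.2 hG0
  have hM1 : 1 ≤ M / ‖G 0‖ := (one_le_div hG0').2 (hM 0 h0)
  have hB : 0 < Real.log (M / ‖G 0‖) + 1 := by linarith [Real.log_nonneg hM1]
  -- The added `1` keeps the bound strictly positive, as Borel–Carathéodory requires.
  set B := Real.log (M / ‖G 0‖) + 1 with hBdef
  have hdd : DifferentiableOn ℂ (fun z => deriv G z / G z) (ball 0 (17 / 10)) :=
    hG.contDiff.differentiable_deriv_two.differentiableOn.fun_div hG.differentiableOn hne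
  obtain ⟨f, hf0, hf⟩ := hdd.isExactOn_ball.with_val_at 0 0
  -- `f` is a logarithm of `G / G 0`: the derivative of `G * exp (-f)` vanishes.
  have hexp : ∀ z ∈ ball (0 : ℂ) (17 / 10), G z = G 0 * cexp (f z) := by
    have hc : ∀ z ∈ ball (0 : ℂ) (17 / 10), HasDerivAt (fun z => G z * cexp (-f z)) 0 z := by
      intro z hz
      have h1 := (hG z).hasDerivAt.fun_mul (hf z hz).fun_neg.cexp
      refine h1.congr_deriv ?_
      have h2 : G z * (deriv G z / G z) = deriv G z := mul_div_cancel₀ _ (hne z hz)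
      linear_combination -(cexp (-f z)) * h2
    intro z hz
    have := (isOpen_ball).is_const_of_deriv_eq_zero (convex_ball (0 : ℂ) (17 / 10)).isPreconnected
      (fun z hz => (hc z hz).differentiableAt.differentiableWithinAt)
      (fun z hz => (hc z hz).deriv) hz h0
    simp only [hf0, neg_zero, Complex.exp_zero, mul_one] at this
    rw [← this, mul_assoc, ← Complex.exp_add]; simp
  have hfd : DifferentiableOn ℂ f (ball 0 (17 / 10)) :=
    fun z hz => (hf z hz).differentiableAt.differentiableWithinAt
  have hre : MapsTo f (ball 0 (17 / 10)) {z | z.re ≤ B} := by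
    intro z hz
    have h1 : ‖G z‖ = ‖G 0‖ * Real.exp (f z).re := by
      rw [hexp z hz, norm_mul, Complex.norm_exp]
    have h2 := hM z hz
    rw [h1] at h2
    have h3 : Real.exp (f z).re ≤ M / ‖G 0‖ := by rw [le_div_iff₀ hG0']; linarith
    have h4 := (Real.le_log_iff_exp_le (by linarith)).2 h3
    simp only [mem_ofPred_eq]; linarith
  -- Borel–Carathéodory with radii `33/20 < 17/10`: `2 * (33/20) / (1/20) = 66`. Cauchy's estimate
  -- on circles of radius `1/40` then gives `2640 = 66 * 40`.
  have hbound : ∀ w ∈ ball (0 : ℂ) (33 / 20), ‖f w‖ ≤ 66 * B := by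
    intro w hw
    have hw' : ‖w‖ < 33 / 20 := by simpa using hw
    have := borelCaratheodory_zero hB hfd hre (by norm_num)
      (ball_subset_ball (by norm_num) hw) hf0
    refine this.trans ?_
    rw [div_le_iff₀ (by linarith)]
    nlinarith
  have hder : deriv f z = deriv G z / G z :=
    (hf z (by simp; linarith)).deriv
  rw [← hder]
  have h20 : ball z (1 / 20) ⊆ ball (0 : ℂ) (33 / 20) := by
    apply ball_subset_ball'
    simp; linarith
  have hsub : closedBall z (1 / 40) ⊆ ball (0 : ℂ) (33 / 20) :=
    (closedBall_subset_ball (by norm_num)).trans h20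
  have := Complex.norm_deriv_le_of_forall_mem_sphere_norm_le (c := z) (R := 1 / 40) (C := 66 * B)
    (f := f) (by norm_num)
    (hfd.diffContOnCl_ball (hsub.trans (ball_subset_ball (by norm_num))))
    (fun w hw => hbound w (hsub (sphere_subset_closedBall hw)))
  linarith

lemma exists_factor_of_eq_zero {h : ℂ → ℂ} (hh : Differentiable ℂ h) {ρ : ℂ} (hρ : h ρ = 0) :
    ∃ k : ℂ → ℂ, Differentiable ℂ k ∧ ∀ z, h z = (z - ρ) * k z := by
  refine ⟨dslope h ρ, ?_, fun z => ?_⟩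
  · rw [← differentiableOn_univ] at hh ⊢
    exact (Complex.differentiableOn_dslope Filter.univ_mem).2 hh
  · have := sub_smul_dslope h ρ z
    rw [hρ, sub_zero, smul_eq_mul] at this
    exact this.symm

/-- If zeros could be divided out forever, Jensen's inequality would give `(R / r) ^ n * ‖g 0‖ ≤ M`
for every `n`. This gives finiteness with multiplicity at once. -/
lemma exists_zeros_factorization {g : ℂ → ℂ} {R r M : ℝ} (hr : 0 < r) (hrR : r < R)
    (hg : Differentiable ℂ g) (hM : ∀ z ∈ closedBall (0 : ℂ) R, ‖g z‖ ≤ M) (h0 : g 0 ≠ 0) :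
    ∃ (Z : Multiset ℂ) (h : ℂ → ℂ), Differentiable ℂ h ∧
      (∀ z, g z = (Z.map (z - ·)).prod * h z) ∧ (∀ ρ ∈ Z, ‖ρ‖ ≤ r) ∧ ∀ z, ‖z‖ ≤ r → h z ≠ 0 := by
  by_contra! hcon
  have hP : ∀ n : ℕ, ∃ (Z : Multiset ℂ) (h : ℂ → ℂ), Z.card = n ∧ Differentiable ℂ h ∧
      (∀ z, g z = (Z.map (z - ·)).prod * h z) ∧ (∀ ρ ∈ Z, ‖ρ‖ ≤ r) := by
    intro n
    induction n with
    | zero => exact ⟨0, g, by simp, hg, by simp, by simp⟩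
    | succ n ih =>
      obtain ⟨Z, h, hc, hh, hfac, hZ⟩ := ih
      obtain ⟨ρ, hρ, hρ0⟩ := hcon Z h hh hfac hZ
      obtain ⟨k, hk, hhk⟩ := exists_factor_of_eq_zero hh hρ0
      refine ⟨ρ ::ₘ Z, k, by simp [hc], hk, fun z => ?_, ?_⟩
      · rw [hfac, hhk]; simp; ring
      · intro x hx
        rcases Multiset.mem_cons.1 hx with rfl | hx
        · exact hρ
        · exact hZ x hx
  have hR : 0 < R := hr.trans hrR
  obtain ⟨n, hn⟩ := pow_unbounded_of_one_lt (M / ‖g 0‖) ((one_lt_div hr).2 hrR)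
  obtain ⟨Z, h, rfl, hh, hfac, hZ⟩ := hP n
  have h1 := pow_card_mul_le hr hR hfac hZ
  have h2 := norm_blaschkeNumerator_mul_le hR hh hM hfac (z := 0) (by simp [hR.le])
  rw [div_lt_iff₀ (norm_pos_iff.2 h0)] at hn
  linarith

lemma logDeriv_multiset_prod (Z : Multiset ℂ) (f f' : ℂ → ℂ → ℂ) (z : ℂ)
    (hf : ∀ ρ ∈ Z, HasDerivAt (f ρ) (f' ρ z) z) (hne : ∀ ρ ∈ Z, f ρ z ≠ 0) :
    HasDerivAt (fun w => (Z.map fun ρ => f ρ w).prod)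
      ((Z.map fun ρ => f ρ z).prod * (Z.map fun ρ => f' ρ z / f ρ z).sum) z := by
  induction Z using Multiset.induction_on with
  | empty => simpa using hasDerivAt_const z (1 : ℂ)
  | cons a s ih =>
    simp only [Multiset.map_cons, Multiset.prod_cons, Multiset.sum_cons]
    have ha := hne a (by simp)
    refine ((hf a (by simp)).fun_mul (ih (fun ρ hρ => hf ρ (by simp [hρ]))
      fun ρ hρ => hne ρ (by simp [hρ]))).congr_deriv ?_
    have h2 : f a z * (f' a z / f a z) = f' a z := mul_div_cancel₀ _ ha
    linear_combination -(s.map fun ρ => f ρ z).prod * h2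

lemma norm_multiset_sum_map_le (Z : Multiset ℂ) (f : ℂ → ℂ) {c : ℝ} (hf : ∀ ρ ∈ Z, ‖f ρ‖ ≤ c) :
    ‖(Z.map f).sum‖ ≤ Z.card * c := by
  induction Z using Multiset.induction_on with
  | empty => simp
  | cons a s ih =>
    simp only [Multiset.map_cons, Multiset.sum_cons, Multiset.card_cons]
    have h1 := hf a (by simp)
    have h2 := ih fun ρ hρ => hf ρ (by simp [hρ])
    have := norm_add_le (f a) (s.map f).sum
    push_cast
    linarith

lemma mul_add_mul_div_mul {P S h d : ℂ} (hP : P ≠ 0) (hh : h ≠ 0) :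
    (P * S * h + P * d) / (P * h) = S + d / h := by
  field_simp

/-- Local partial fraction expansion of the logarithmic derivative of an entire function. -/
lemma exists_zeros_norm_logDeriv_sub_le {g : ℂ → ℂ} {M : ℝ} (hg : Differentiable ℂ g)
    (hM : ∀ z ∈ closedBall (0 : ℂ) (7 / 4), ‖g z‖ ≤ M) (h0 : g 0 ≠ 0) :
    ∃ Z : Multiset ℂ, (∀ ρ ∈ Z, g ρ = 0 ∧ ‖ρ‖ ≤ 17 / 10) ∧
      (Z.card : ℝ) ≤ 40 * (Real.log (M / ‖g 0‖) + 1) ∧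
      ∀ z, ‖z‖ ≤ 8 / 5 → g z ≠ 0 →
        ‖deriv g z / g z - (Z.map fun ρ => 1 / (z - ρ)).sum‖ ≤
          4000 * (Real.log (M / ‖g 0‖) + 1) := by
  obtain ⟨Z, h, hh, hfac, hZ, hne⟩ :=
    exists_zeros_factorization (R := 7 / 4) (r := 17 / 10) (by norm_num) (by norm_num) hg hM h0
  have hg0 : 0 < ‖g 0‖ := norm_pos_iff.2 h0
  have hM0 : ‖g 0‖ ≤ M := hM 0 (by simp; norm_num)
  have hMpos : 0 < M := hg0.trans_le hM0
  set B := Real.log (M / ‖g 0‖) + 1 with hB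
  have hpow := pow_card_mul_le (R := 7 / 4) (by norm_num) (by norm_num) hfac hZ
  have hGM := fun z hz => norm_blaschkeNumerator_mul_le (R := 7 / 4) (z := z)
    (by norm_num) hh hM hfac hz
  set G : ℂ → ℂ := fun z => blaschkeNumerator (7 / 4) Z z * h z with hG
  have hGd : Differentiable ℂ G := (differentiable_blaschkeNumerator _ Z).fun_mul hh
  have hG0 : ‖g 0‖ ≤ ‖G 0‖ := by
    refine le_trans ?_ hpow
    exact le_mul_of_one_le_left hg0.le (one_le_pow₀ (by norm_num))
  have hcard : (Z.card : ℝ) ≤ 40 * B := by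
    have h1 : (7 / 4 / (17 / 10) : ℝ) ^ Z.card ≤ M / ‖g 0‖ := by
      rw [le_div_iff₀ hg0]; exact hpow.trans (hGM 0 (by simp; norm_num))
    have h2 := Real.log_le_log (by positivity) h1
    rw [Real.log_pow] at h2
    -- The ratio of the radii is `35/34`, whose logarithm is at least `1/35`.
    have h3 : (1 / 40 : ℝ) ≤ Real.log (7 / 4 / (17 / 10)) := by
      have := Real.one_sub_inv_le_log_of_pos (x := 7 / 4 / (17 / 10)) (by norm_num)
      norm_num at this ⊢
      linarith
    have h4 : (0 : ℝ) ≤ Z.card := by positivity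
    nlinarith
  have hfne : ∀ z : ℂ, ‖z‖ ≤ 17 / 10 → ∀ ρ ∈ Z,
      (9 / 100 : ℝ) ≤ ‖(((7 / 4 : ℝ) : ℂ) ^ 2 - (starRingEnd ℂ) ρ * z) / ((7 / 4 : ℝ) : ℂ)‖ := by
    intro z hz ρ hρ
    have h1 := blaschkeNumerator_factor_ne_zero (R := 7 / 4) (by norm_num) (hZ ρ hρ) hz
    rw [norm_div, le_div_iff₀ (by rw [norm_real]; norm_num), norm_real]
    norm_num at h1 ⊢
    linarith
  have hGne : ∀ z ∈ ball (0 : ℂ) (17 / 10), G z ≠ 0 := by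
    intro z hz
    have hz' : ‖z‖ ≤ 17 / 10 := by simpa using (mem_ball.1 hz).le
    refine mul_ne_zero ?_ (hne z hz')
    unfold blaschkeNumerator
    rw [Ne, Multiset.prod_eq_zero_iff, Multiset.mem_map]
    rintro ⟨ρ, hρ, h1⟩
    have := hfne z hz' ρ hρ
    rw [h1, norm_zero] at this
    norm_num at this
  have hlogG : Real.log (M / ‖G 0‖) + 1 ≤ B := by
    rw [hB]; gcongr
    exact div_pos hMpos (hg0.trans_le hG0)
  refine ⟨Z, fun ρ hρ => ?_, hcard, fun z hz hgz => ?_⟩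
  · refine ⟨?_, hZ ρ hρ⟩
    rw [hfac, Multiset.prod_eq_zero]
    · simp
    · exact Multiset.mem_map.2 ⟨ρ, hρ, by simp⟩
  · have hz' : ‖z‖ ≤ 17 / 10 := hz.trans (by norm_num)
    have hz0 : z ∈ ball (0 : ℂ) (17 / 10) := by simp; linarith
    have hzρ : ∀ ρ ∈ Z, z - ρ ≠ 0 := by
      intro ρ hρ h1
      apply hgz
      rw [hfac, Multiset.prod_eq_zero (Multiset.mem_map.2 ⟨ρ, hρ, h1⟩), zero_mul]
    have hd1 := (logDeriv_multiset_prod Z (fun ρ w => w - ρ) (fun _ _ => 1) z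
      (fun ρ _ => (hasDerivAt_id z).sub_const ρ) hzρ).fun_mul (hh z).hasDerivAt
    have hd2 := (logDeriv_multiset_prod Z
      (fun ρ w => (((7 / 4 : ℝ) : ℂ) ^ 2 - (starRingEnd ℂ) ρ * w) / ((7 / 4 : ℝ) : ℂ))
      (fun ρ _ => (-(starRingEnd ℂ) ρ) / ((7 / 4 : ℝ) : ℂ)) z
      (fun ρ _ => by
        simpa using (((hasDerivAt_id z).const_mul ((starRingEnd ℂ) ρ)).const_sub
          (((7 / 4 : ℝ) : ℂ) ^ 2)).div_const ((7 / 4 : ℝ) : ℂ))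
      (fun ρ hρ h1 => by
        have := hfne z hz' ρ hρ
        rw [h1, norm_zero] at this
        norm_num at this)).fun_mul (hh z).hasDerivAt
    have hhz := hne z hz'
    have hge : g = fun w => (Z.map fun ρ => w - ρ).prod * h w := funext hfac
    have e1 : deriv g z / g z = (Z.map fun ρ => 1 / (z - ρ)).sum + deriv h z / h z := by
      have hp : (Z.map fun ρ => z - ρ).prod ≠ 0 := by
        intro h1; exact hgz (by rw [hfac, h1, zero_mul])
      rw [hge, hd1.deriv]
      exact mul_add_mul_div_mul hp hhz
    have e2 := hd2.deriv
    have e3 : deriv G z / G z = (Z.map fun ρ => (-(starRingEnd ℂ) ρ) / ((7 / 4 : ℝ) : ℂ) /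
        ((((7 / 4 : ℝ) : ℂ) ^ 2 - (starRingEnd ℂ) ρ * z) / ((7 / 4 : ℝ) : ℂ))).sum +
          deriv h z / h z := by
      have hp := left_ne_zero_of_mul (hGne z hz0)
      unfold blaschkeNumerator at hp
      rw [hG]
      unfold blaschkeNumerator
      rw [e2]
      exact mul_add_mul_div_mul hp hhz
    have b1 := norm_multiset_sum_map_le Z (fun ρ => (-(starRingEnd ℂ) ρ) / ((7 / 4 : ℝ) : ℂ) /
        ((((7 / 4 : ℝ) : ℂ) ^ 2 - (starRingEnd ℂ) ρ * z) / ((7 / 4 : ℝ) : ℂ))) (c := 11) (by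
      intro ρ hρ
      have h1 := hfne z hz' ρ hρ
      rw [norm_div, div_le_iff₀ (by linarith), norm_div, norm_neg, Complex.norm_conj, norm_real,
        Real.norm_of_nonneg (by norm_num), div_le_iff₀ (by norm_num)]
      have := hZ ρ hρ
      linarith)
    have b2 := norm_deriv_div_le hGd hGne (fun z hz => hGM z (by
      have : ‖z‖ < 17 / 10 := by simpa using hz
      simp; linarith)) hz
    -- Both sides equal `h'/h`. On the right `G` is zero-free and bounded by `M`, and the subtracted
    -- Blaschke terms are at most `11` each, so the total is at most `2640 + 11 * 40 ≤ 4000` times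
    -- the bound.
    have e4 : deriv g z / g z - (Z.map fun ρ => 1 / (z - ρ)).sum = deriv G z / G z -
        (Z.map fun ρ => (-(starRingEnd ℂ) ρ) / ((7 / 4 : ℝ) : ℂ) /
        ((((7 / 4 : ℝ) : ℂ) ^ 2 - (starRingEnd ℂ) ρ * z) / ((7 / 4 : ℝ) : ℂ))).sum := by
      rw [e1, e3]; ring
    rw [e4]
    refine (norm_sub_le _ _).trans ?_
    linarith

end ElkiesPrimes

end

/-! ### Dirichlet `L`-functions: growth, and `L'/L` to the right of the critical line under GRH. -/

section

open Complex Metric Set Filter Topology MeasureTheory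

namespace ElkiesPrimes

lemma sum_range_zmod_add {m : ℕ} [NeZero m] {A : Type*} [AddCommMonoid A] (f : ZMod m → A)
    (a : ZMod m) : ∑ k ∈ Finset.range m, f (a + k) = ∑ x, f x := by
  refine Finset.sum_nbij' (fun k => a + k) (fun x => (x - a).val) ?_ ?_ ?_ ?_ ?_
  · simp
  · intro x _; simpa using ZMod.val_lt _
  · intro k hk
    simp [ZMod.val_cast_of_lt (Finset.mem_range.1 hk)]
  · simp
  · simp

/-- Complete periods cancel, which leaves fewer than `m` terms. -/
lemma norm_sum_range_le_of_sum_eq_zero {m : ℕ} [NeZero m] {f : ZMod m → ℂ} (h0 : ∑ x, f x = 0)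
    (h1 : ∀ x, ‖f x‖ ≤ 1) (n : ℕ) : ‖∑ k ∈ Finset.range n, f k‖ ≤ m := by
  induction n using Nat.strong_induction_on with
  | _ n ih =>
    rcases lt_or_ge n m with h | h
    · refine (norm_sum_le _ _).trans ((Finset.sum_le_card_nsmul _ _ 1 fun _ _ => h1 _).trans ?_)
      simp only [Finset.card_range, nsmul_eq_mul, mul_one]
      exact_mod_cast h.le
    · obtain ⟨k, rfl⟩ := Nat.exists_eq_add_of_le' h
      rw [Finset.sum_range_add]
      have := sum_range_zmod_add f (k : ZMod m)
      push_cast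
      rw [this, h0, add_zero]
      exact ih k (by have := NeZero.pos m; omega)

section LFunction

variable {m : ℕ} {χ : DirichletCharacter ℂ m}

/-- The summatory function of a Dirichlet character. -/
noncomputable def characterSum (χ : DirichletCharacter ℂ m) (t : ℝ) : ℂ :=
  ∑ k ∈ Finset.Icc 1 ⌊t⌋₊, χ (k : ZMod m)

lemma measurable_characterSum : Measurable (characterSum χ) :=
  (measurable_of_countable fun n : ℕ => ∑ k ∈ Finset.Icc 1 n, χ (k : ZMod m)).comp
    Nat.measurable_floor

lemma characterSum_of_lt_one {t : ℝ} (ht : t < 1) : characterSum χ t = 0 := by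
  simp [characterSum, Nat.floor_eq_zero.2 ht]

lemma mellin_characterSum_eq (w : ℂ) :
    mellin (characterSum χ) w = ∫ t in Ioi (1 : ℝ), characterSum χ t * (t : ℂ) ^ (w - 1) := by
  rw [mellin]
  rw [← integral_Ici_eq_integral_Ioi (x := (1 : ℝ)),
    setIntegral_eq_of_subset_of_forall_sdiff_eq_zero measurableSet_Ioi (s := Ici 1)]
  · simp only [smul_eq_mul, mul_comm]
  · intro x hx; exact lt_of_lt_of_le (one_pos : (0 : ℝ) < 1) hx
  · intro x hx
    rw [characterSum_of_lt_one (not_le.1 hx.2), smul_zero]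

variable [NeZero m]

lemma two_le_modulus (hχ : χ ≠ 1) : 2 ≤ m := by
  by_contra h
  have h1 : m = 1 := by have := NeZero.pos m; omega
  subst h1
  exact hχ (Subsingleton.elim _ _)

lemma norm_sum_Icc_character_le (hχ : χ ≠ 1) (n : ℕ) :
    ‖∑ k ∈ Finset.Icc 1 n, χ (k : ZMod m)‖ ≤ m := by
  have h := norm_sum_range_le_of_sum_eq_zero (χ.sum_eq_zero_of_ne_one hχ)
    (fun x => χ.norm_le_one x) (n + 1)
  rw [Finset.range_eq_Ico, Finset.sum_eq_sum_Ico_succ_bot (Nat.succ_pos n)] at h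
  have h0 : χ ((0 : ℕ) : ZMod m) = 0 := by
    have : Fact (1 < m) := ⟨two_le_modulus hχ⟩
    rw [Nat.cast_zero]; exact χ.map_zero
  rw [h0, zero_add] at h
  exact h

lemma differentiableAt_mellin_characterSum (hχ : χ ≠ 1) {w : ℂ} (hw : w.re < 0) :
    DifferentiableAt ℂ (mellin (characterSum χ)) w := by
  refine mellin_differentiableAt_of_isBigO_rpow (a := 0) (b := w.re - 1) ?_ ?_ hw ?_ (by linarith)
  · refine LocallyIntegrable.locallyIntegrableOn ?_ _
    refine (locallyIntegrable_const (m : ℝ)).mono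
      (measurable_characterSum.aestronglyMeasurable) (Eventually.of_forall fun t => ?_)
    simpa [characterSum] using norm_sum_Icc_character_le hχ ⌊t⌋₊
  · refine Asymptotics.IsBigO.of_bound m (Eventually.of_forall fun t => ?_)
    simpa [characterSum] using norm_sum_Icc_character_le hχ ⌊t⌋₊
  · refine Asymptotics.IsBigO.of_bound 1 ?_
    have : Ioo (0 : ℝ) 1 ∈ 𝓝[>] (0 : ℝ) := Ioo_mem_nhdsGT one_pos
    filter_upwards [this] with t ht
    rw [characterSum_of_lt_one ht.2]
    simp

/-- Abel summation proves this for `Re s > 1`. The character sums are bounded, so the right side is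
analytic for `Re s > 0`, and the identity theorem extends the equality. The bound
`norm_LFunction_le` follows by inserting `|S(t)| ≤ m`. -/
lemma LFunction_eq_mul_mellin (hχ : χ ≠ 1) {s : ℂ} (hs : 0 < s.re) :
    χ.LFunction s = s * mellin (characterSum χ) (-s) := by
  have hU : IsOpen {z : ℂ | 0 < z.re} := isOpen_lt continuous_const Complex.continuous_re
  have h1 : AnalyticOnNhd ℂ χ.LFunction {z : ℂ | 0 < z.re} :=
    ((DirichletCharacter.differentiable_LFunction hχ).differentiableOn).analyticOnNhd hU
  have h2 : AnalyticOnNhd ℂ (fun s => s * mellin (characterSum χ) (-s)) {z : ℂ | 0 < z.re} := by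
    refine DifferentiableOn.analyticOnNhd (fun z hz => ?_) hU
    have hz' : (-z).re < 0 := by simpa using hz
    have := (differentiableAt_mellin_characterSum hχ hz').comp z (by fun_prop :
      DifferentiableAt ℂ (fun z : ℂ => -z) z)
    exact (differentiableAt_id.mul this).differentiableWithinAt
  have hconv : IsPreconnected {z : ℂ | 0 < z.re} := (convex_halfSpace_re_gt 0).isPreconnected
  refine h1.eqOn_of_preconnected_of_eventuallyEq h2 hconv (z₀ := 2) (by simp) ?_ hs
  have hV : {z : ℂ | 1 < z.re} ∈ 𝓝 (2 : ℂ) :=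
    (isOpen_lt continuous_const Complex.continuous_re).mem_nhds (by simp)
  filter_upwards [hV] with z hz
  rw [DirichletCharacter.LFunction_eq_LSeries _ hz, mellin_characterSum_eq,
    LSeries_eq_mul_integral (r := 0) _ le_rfl (lt_trans one_pos hz)
      (DirichletCharacter.LSeriesSummable_of_one_lt_re χ hz)]
  · simp only [characterSum, neg_add, sub_eq_add_neg]
  · refine Asymptotics.IsBigO.of_bound m (Eventually.of_forall fun n => ?_)
    simpa using norm_sum_Icc_character_le hχ n

lemma norm_LFunction_le (hχ : χ ≠ 1) {s : ℂ} (hs : 0 < s.re) :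
    ‖χ.LFunction s‖ ≤ m * ‖s‖ / s.re := by
  have hb : ‖mellin (characterSum χ) (-s)‖ ≤ m / s.re := by
    rw [mellin_characterSum_eq]
    have hi : IntegrableOn (fun t : ℝ => (m : ℝ) * t ^ (-s.re - 1)) (Ioi 1) :=
      (integrableOn_Ioi_rpow_of_lt (by linarith) one_pos).const_mul _
    refine (norm_integral_le_of_norm_le hi ?_).trans ?_
    · filter_upwards [ae_restrict_mem measurableSet_Ioi] with t ht
      have ht0 : 0 < t := one_pos.trans ht
      rw [norm_mul, Complex.norm_cpow_eq_rpow_re_of_pos ht0]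
      simp only [sub_re, neg_re, one_re]
      gcongr
      exact norm_sum_Icc_character_le hχ _
    · rw [integral_const_mul, integral_Ioi_rpow_of_lt (by linarith) one_pos]
      simp
      apply le_of_eq
      rw [div_eq_mul_inv]
  rw [LFunction_eq_mul_mellin hχ hs, norm_mul]
  calc ‖s‖ * _ ≤ ‖s‖ * (m / s.re) := by gcongr
    _ = _ := by ring

/-- The terms past the first total at most `ζ(2) - 1`, and `2 - π²/6 > 1/3`. This bounds from below
the central value in Jensen's inequality. -/
lemma one_third_le_norm_LFunction {s : ℂ} (hs : s.re = 2) : 1 / 3 ≤ ‖χ.LFunction s‖ := by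
  have hs1 : 1 < s.re := by rw [hs]; norm_num
  have h1 := (DirichletCharacter.LSeriesSummable_of_one_lt_re χ hs1).LSeriesHasSum
  rw [LSeriesHasSum, ← DirichletCharacter.LFunction_eq_LSeries _ hs1] at h1
  have h2 := (h1.sub (hasSum_ite_eq 1 (1 : ℂ))).norm_le_of_bounded
    (hasSum_zeta_two.sub (hasSum_ite_eq 1 (1 : ℝ))) (fun n => by
      rcases eq_or_ne n 1 with rfl | h
      · simp [LSeries.term]
      · rcases eq_or_ne n 0 with rfl | h0
        · simp
        · simp only [h, if_false, sub_zero]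
          rw [LSeries.norm_term_eq, if_neg h0, hs]
          gcongr
          · exact χ.norm_le_one _
          · norm_num)
  have h3 := norm_sub_norm_le (1 : ℂ) (1 - χ.LFunction s)
  rw [norm_one, sub_sub_cancel, norm_sub_rev] at h3
  have := Real.pi_lt_d2
  have := Real.pi_pos
  nlinarith

lemma norm_LFunction_disc_le (hχ : χ ≠ 1) (t : ℝ) {z : ℂ} (hz : z ∈ closedBall (0 : ℂ) (7 / 4)) :
    ‖χ.LFunction (2 + t * I + z)‖ ≤ 4 * m * (|t| + 4) := by
  have hz' : ‖z‖ ≤ 7 / 4 := by simpa using hz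
  have h1 := (abs_le.1 (Complex.abs_re_le_norm z)).1
  -- Radius `7/4` about `2 + it` stays in `Re s ≥ 1/4`, inside the half-plane of the growth bound.
  have hre : 1 / 4 ≤ (2 + t * I + z).re := by simp; linarith
  have hn : ‖2 + t * I + z‖ ≤ |t| + 4 := by
    have h2 := norm_add_le (2 + t * I : ℂ) z
    have h3 := norm_add_le (2 : ℂ) (t * I)
    simp at h3
    linarith
  refine (norm_LFunction_le hχ (by linarith)).trans ?_
  rw [div_le_iff₀ (by linarith)]
  calc (m : ℝ) * ‖2 + t * I + z‖ ≤ 4 * m * (|t| + 4) * (1 / 4) := by nlinarith [Nat.cast_nonneg (α := ℝ) m]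
    _ ≤ _ := by gcongr

/-- The logarithmic size of the analytic conductor. -/
noncomputable def logConductor (m : ℕ) (t : ℝ) : ℝ := Real.log (m * (|t| + 2))

lemma one_le_logConductor {m : ℕ} (hm : 2 ≤ m) (t : ℝ) : 1 ≤ logConductor m t := by
  have h1 : (2 : ℝ) ≤ m := by exact_mod_cast hm
  rw [logConductor, Real.le_log_iff_exp_le (by positivity)]
  have := Real.exp_one_lt_d9
  have := abs_nonneg t
  nlinarith

lemma log_div_le_logConductor (hχ : χ ≠ 1) (t : ℝ) :
    Real.log (4 * m * (|t| + 4) / ‖χ.LFunction (2 + t * I)‖) + 1 ≤ 5 * logConductor m t := by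
  have h1 : 1 / 3 ≤ ‖χ.LFunction (2 + t * I)‖ := one_third_le_norm_LFunction (by simp)
  have hm := two_le_modulus hχ
  have hm' : (2 : ℝ) ≤ m := by exact_mod_cast hm
  have h2 := one_le_logConductor hm t
  have ht := abs_nonneg t
  have h3 : 4 * m * (|t| + 4) / ‖χ.LFunction (2 + t * I)‖ ≤ (m * (|t| + 2)) ^ 4 := by
    rw [div_le_iff₀ (by linarith)]
    have h4 : 4 ≤ (m * (|t| + 2)) := by nlinarith
    have h5 : (4 : ℝ) ^ 3 ≤ (m * (|t| + 2)) ^ 3 := by gcongr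
    calc 4 * m * (|t| + 4) ≤ 4 ^ 3 * (m * (|t| + 2)) * (1 / 3) := by nlinarith
      _ ≤ (m * (|t| + 2)) ^ 3 * (m * (|t| + 2)) * ‖χ.LFunction (2 + t * I)‖ := by gcongr
      _ = _ := by ring
  have h4 := Real.log_le_log (by positivity) h3
  rw [Real.log_pow] at h4
  simp only [logConductor] at h2 ⊢
  push_cast at h4
  linarith

/-- GRH speaks only of the open strip; zeros with `Re s ≥ 1` are excluded by nonvanishing there. -/
lemma re_eq_half_of_LFunction_eq_zero (hGRH : GRH) (hχ : χ ≠ 1) {s : ℂ}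
    (h0 : χ.LFunction s = 0) (hs : 0 < s.re) : s.re = 1 / 2 := by
  refine hGRH m χ s h0 hs ?_
  by_contra! h
  exact DirichletCharacter.LFunction_ne_zero_of_one_le_re χ (.inl hχ) h h0

lemma LFunction_ne_zero_of_half_lt_re (hGRH : GRH) (hχ : χ ≠ 1) {s : ℂ}
    (hs : 1 / 2 < s.re) : χ.LFunction s ≠ 0 := by
  intro h0
  have := re_eq_half_of_LFunction_eq_zero hGRH hχ h0 (by linarith)
  linarith

/-- Local partial fraction expansion of `L'/L` under the Riemann hypothesis. -/
lemma exists_ordinates_norm_logDeriv_sub_le (hGRH : GRH) (hχ : χ ≠ 1) (t₀ : ℝ) :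
    ∃ Z : Multiset ℂ, (∀ ρ ∈ Z, ρ.re = 1 / 2) ∧ (Z.card : ℝ) ≤ 200 * logConductor m t₀ ∧
      ∀ s : ℂ, 1 / 2 < s.re → s.re ≤ 2 → |s.im - t₀| ≤ 1 / 2 →
        ‖deriv χ.LFunction s / χ.LFunction s - (Z.map fun ρ => 1 / (s - ρ)).sum‖ ≤
          20000 * logConductor m t₀ := by
  have hd := DirichletCharacter.differentiable_LFunction hχ
  set c : ℂ := 2 + t₀ * I with hc
  have hcre : c.re = 2 := by simp [hc]
  have hcim : c.im = t₀ := by simp [hc]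
  have hgd : Differentiable ℂ fun z => χ.LFunction (c + z) := by fun_prop
  have h0 : χ.LFunction (c + 0) ≠ 0 :=
    LFunction_ne_zero_of_half_lt_re hGRH hχ (by simp [hcre]; norm_num)
  obtain ⟨Z, hZ, hcard, hmain⟩ := exists_zeros_norm_logDeriv_sub_le hgd
    (fun z hz => norm_LFunction_disc_le hχ t₀ hz) h0
  have hB := log_div_le_logConductor hχ t₀
  rw [add_zero] at hcard hmain
  refine ⟨Z.map (c + ·), ?_, ?_, ?_⟩
  · intro ρ hρ
    obtain ⟨z, hz, rfl⟩ := Multiset.mem_map.1 hρ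
    refine re_eq_half_of_LFunction_eq_zero hGRH hχ (hZ z hz).1 ?_
    have h1 := (abs_le.1 (Complex.abs_re_le_norm z)).1
    have := (hZ z hz).2
    simp only [add_re, hcre]
    linarith
  · rw [Multiset.card_map]; linarith
  · intro s hs1 hs2 hs3
    -- The farthest corners have squared distance at most `(3/2)² + (1/2)² = 2.5 < (8/5)²`.
    have hz : ‖s - c‖ ≤ 8 / 5 := by
      have e1 : (s - c).re = s.re - 2 := by simp [hcre]
      have e2 : (s - c).im = s.im - t₀ := by simp [hcim]
      rw [← sq_le_sq₀ (norm_nonneg _) (by norm_num), Complex.sq_norm, Complex.normSq_apply, e1, e2]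
      have := abs_le.1 hs3
      nlinarith
    have h1 := hmain (s - c) hz (by
      rw [add_sub_cancel]; exact LFunction_ne_zero_of_half_lt_re hGRH hχ hs1)
    have h2 : deriv (fun z => χ.LFunction (c + z)) (s - c) = deriv χ.LFunction s := by
      rw [deriv_comp_const_add, add_sub_cancel]
    rw [h2, add_sub_cancel] at h1
    rw [Multiset.map_map]
    simp only [Function.comp_def, ← sub_sub]
    linarith

/-- Each nearby zero lies at distance at least `Re s - 1/2`. Close to the critical line this is too
weak for the final estimate; there it only justifies convergence and contour shifts. -/
lemma norm_logDeriv_LFunction_le (hGRH : GRH) (hχ : χ ≠ 1) {s : ℂ} (h1 : 1 / 2 < s.re)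
    (h2 : s.re ≤ 2) : ‖deriv χ.LFunction s / χ.LFunction s‖ ≤
      40000 * logConductor m s.im / (s.re - 1 / 2) := by
  obtain ⟨Z, hZ, hcard, hmain⟩ := exists_ordinates_norm_logDeriv_sub_le hGRH hχ s.im
  have h3 := hmain s h1 h2 (by simp)
  have hL := one_le_logConductor (two_le_modulus hχ) s.im
  have h4 := norm_multiset_sum_map_le Z (fun ρ => 1 / (s - ρ)) (c := 1 / (s.re - 1 / 2)) (by
    intro ρ hρ
    rw [norm_div, norm_one]
    apply one_div_le_one_div_of_le (by linarith)
    have := Complex.abs_re_le_norm (s - ρ)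
    rw [sub_re, hZ ρ hρ] at this
    exact (le_abs_self _).trans this)
  have h5 := norm_le_norm_sub_add (deriv χ.LFunction s / χ.LFunction s)
    (Z.map fun ρ => 1 / (s - ρ)).sum
  rw [le_div_iff₀ (by linarith)]
  have h6 : (Z.card : ℝ) * (1 / (s.re - 1 / 2)) * (s.re - 1 / 2) = Z.card := by
    have : s.re - 1 / 2 ≠ 0 := by linarith
    rw [mul_assoc, one_div_mul_cancel this, mul_one]
  have h7 : 0 < s.re - 1 / 2 := by linarith
  calc _ ≤ (20000 * logConductor m s.im + Z.card * (1 / (s.re - 1 / 2))) * (s.re - 1 / 2) := by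
        gcongr; linarith
    _ = 20000 * logConductor m s.im * (s.re - 1 / 2) + Z.card := by rw [add_mul, h6]
    _ ≤ _ := by nlinarith

lemma integral_poissonKernel_le_pi {c : ℝ} (hc : 0 < c) (γ : ℝ) {a b : ℝ} :
    ∫ t in a..b, c / (c ^ 2 + (t - γ) ^ 2) ≤ Real.pi := by
  have h : ∀ t ∈ uIcc a b, HasDerivAt (fun t => Real.arctan ((t - γ) / c))
      (c / (c ^ 2 + (t - γ) ^ 2)) t := by
    intro t _
    have := (((hasDerivAt_id t).sub_const γ).div_const c).arctan
    refine this.congr_deriv ?_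
    simp only [id]
    field_simp
  rw [intervalIntegral.integral_eq_sub_of_hasDerivAt h]
  · have h1 := Real.arctan_lt_pi_div_two ((b - γ) / c)
    have h2 := Real.neg_pi_div_two_lt_arctan ((a - γ) / c)
    linarith
  · apply Continuous.intervalIntegrable
    refine continuous_const.div (by fun_prop) fun t => ?_
    positivity

lemma re_one_div_sub {s ρ : ℂ} :
    (1 / (s - ρ)).re = (s.re - ρ.re) / ((s.re - ρ.re) ^ 2 + (s.im - ρ.im) ^ 2) := by
  rw [one_div, Complex.inv_re, Complex.normSq_apply]
  simp [pow_two]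

lemma continuous_multiset_sum_poisson (Z : Multiset ℂ) {c : ℝ} (hc : 0 < c) {a b : ℝ} :
    Continuous (fun t : ℝ => (Z.map fun ρ : ℂ => c / (c ^ 2 + (t - ρ.im) ^ 2)).sum) ∧
    ∫ t in a..b, (Z.map fun ρ : ℂ => c / (c ^ 2 + (t - ρ.im) ^ 2)).sum ≤ Z.card * Real.pi := by
  induction Z using Multiset.induction_on with
  | empty => simp [continuous_const]
  | cons x s ih =>
    have hx : Continuous fun t : ℝ => c / (c ^ 2 + (t - x.im) ^ 2) :=
      continuous_const.div (by fun_prop) fun t => by positivity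
    simp only [Multiset.map_cons, Multiset.sum_cons, Multiset.card_cons]
    refine ⟨hx.add ih.1, ?_⟩
    rw [intervalIntegral.integral_add (hx.intervalIntegrable _ _) (ih.1.intervalIntegrable _ _)]
    have := integral_poissonKernel_le_pi hc x.im (a := a) (b := b)
    push_cast
    linarith [ih.2]

lemma continuous_logDeriv_LFunction_vertical (hGRH : GRH) (hχ : χ ≠ 1) {σ : ℝ} (h1 : 1 / 2 < σ) :
    Continuous fun t : ℝ => deriv χ.LFunction (σ + t * I) / χ.LFunction (σ + t * I) := by
  have hd := DirichletCharacter.differentiable_LFunction hχ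
  have hd' : Differentiable ℂ (deriv χ.LFunction) := hd.contDiff.differentiable_deriv_two
  refine Continuous.div ?_ ?_ fun t => LFunction_ne_zero_of_half_lt_re hGRH hχ (by simpa using h1)
  · exact hd'.continuous.comp (by fun_prop)
  · exact hd.continuous.comp (by fun_prop)

/-- The real part of `L'/L` has bounded mean value on segments of length one, uniformly up to the
critical line. -/
lemma integral_abs_re_logDeriv_le (hGRH : GRH) (hχ : χ ≠ 1) {σ : ℝ} (h1 : 1 / 2 < σ)
    (h2 : σ ≤ 2) (t₀ : ℝ) :
    ∫ t in (t₀ - 1 / 2)..(t₀ + 1 / 2),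
      |(deriv χ.LFunction (σ + t * I) / χ.LFunction (σ + t * I)).re| ≤
        21000 * logConductor m t₀ := by
  obtain ⟨Z, hZ, hcard, hmain⟩ := exists_ordinates_norm_logDeriv_sub_le hGRH hχ t₀
  have hc : 0 < σ - 1 / 2 := by linarith
  obtain ⟨hcont, hint⟩ := continuous_multiset_sum_poisson Z hc
    (a := t₀ - 1 / 2) (b := t₀ + 1 / 2)
  have hL := one_le_logConductor (two_le_modulus hχ) t₀
  -- All zeros lie on `Re s = 1/2`, so the real parts are Poisson kernels of one common width:
  -- positive, and of mass at most `π` however small `σ - 1/2` is.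
  have hre : ∀ s : ℂ, s.re = σ → (Z.map fun ρ => 1 / (s - ρ)).sum.re =
      (Z.map fun ρ : ℂ => (σ - 1 / 2) / ((σ - 1 / 2) ^ 2 + (s.im - ρ.im) ^ 2)).sum := by
    intro s hs
    rw [← Complex.coe_reAddGroupHom, map_multiset_sum, Multiset.map_map]
    congr 1
    refine Multiset.map_congr rfl fun ρ hρ => ?_
    simp only [Function.comp_apply, coe_reAddGroupHom]
    rw [re_one_div_sub, hs, hZ ρ hρ]
  have hnonneg : ∀ t : ℝ,
      0 ≤ (Z.map fun ρ : ℂ => (σ - 1 / 2) / ((σ - 1 / 2) ^ 2 + (t - ρ.im) ^ 2)).sum := by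
    intro t
    refine Multiset.sum_nonneg fun x hx => ?_
    obtain ⟨ρ, _, rfl⟩ := Multiset.mem_map.1 hx
    positivity
  have hpt : ∀ t ∈ Icc (t₀ - 1 / 2) (t₀ + 1 / 2),
      |(deriv χ.LFunction (σ + t * I) / χ.LFunction (σ + t * I)).re| ≤
      (Z.map fun ρ : ℂ => (σ - 1 / 2) / ((σ - 1 / 2) ^ 2 + (t - ρ.im) ^ 2)).sum +
        20000 * logConductor m t₀ := by
    intro t ht
    have h3 := hmain (σ + t * I) (by simpa using h1) (by simpa using h2) (by
      rw [abs_le]; simp; constructor <;> linarith [ht.1, ht.2])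
    have h4 := (Complex.abs_re_le_norm _).trans h3
    rw [sub_re, hre _ (by simp)] at h4
    have h5 := abs_sub_abs_le_abs_sub
      (deriv χ.LFunction (σ + t * I) / χ.LFunction (σ + t * I)).re
      (Z.map fun ρ : ℂ => (σ - 1 / 2) / ((σ - 1 / 2) ^ 2 + (t - ρ.im) ^ 2)).sum
    rw [abs_of_nonneg (hnonneg t)] at h5
    simp at h4 h5 ⊢
    linarith
  have hF := continuous_logDeriv_LFunction_vertical hGRH hχ h1
  refine (intervalIntegral.integral_mono_on (by linarith)
    (((continuous_re.comp hF).abs).intervalIntegrable _ _)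
    ((hcont.fun_add continuous_const).intervalIntegrable _ _) hpt).trans ?_
  rw [intervalIntegral.integral_add (hcont.intervalIntegrable _ _)
    (continuous_const.intervalIntegrable _ _), intervalIntegral.integral_const]
  have := Real.pi_lt_d2
  have : (Z.card : ℝ) * Real.pi ≤ 200 * logConductor m t₀ * 3.15 := by gcongr
  simp only [smul_eq_mul]
  nlinarith

end LFunction

end ElkiesPrimes

end

/-! ### The trapezoidal cutoff, its Mellin transform, and shifts of vertical contours. -/

section

open Complex Metric Set Filter Topology MeasureTheory

namespace ElkiesPrimes

/-- The ramp function `y ↦ max (a - y) 0`. -/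
noncomputable def ramp (a y : ℝ) : ℝ := max (a - y) 0

/-- The trapezoidal cutoff: `1` on `[0, x]`, `0` on `[x + h, ∞)`, linear in between. -/
noncomputable def cutoff (x h y : ℝ) : ℝ := (ramp (x + h) y - ramp x y) / h

/-- The Mellin transform of `cutoff x h`. -/
noncomputable def cutoffTransform (x h : ℝ) (s : ℂ) : ℂ :=
  (((x + h : ℝ) : ℂ) ^ (s + 1) - (x : ℂ) ^ (s + 1)) / (h * (s * (s + 1)))

lemma continuous_cutoff (x h : ℝ) : Continuous (cutoff x h) := by
  unfold cutoff ramp; fun_prop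

lemma cutoff_of_le {x h y : ℝ} (hh : 0 < h) (hy : y ≤ x) : cutoff x h y = 1 := by
  rw [cutoff, ramp, ramp, max_eq_left (by linarith), max_eq_left (by linarith)]
  field_simp; ring

lemma cutoff_of_ge {x h y : ℝ} (hh : 0 < h) (hy : x + h ≤ y) : cutoff x h y = 0 := by
  rw [cutoff, ramp, ramp, max_eq_right (by linarith), max_eq_right (by linarith)]
  simp

lemma cutoff_nonneg {x h : ℝ} (hh : 0 < h) (y : ℝ) : 0 ≤ cutoff x h y := by
  rw [cutoff, ramp, ramp]
  refine div_nonneg (sub_nonneg.2 (max_le_max_right _ (by linarith))) hh.le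

lemma cutoff_le_one {x h : ℝ} (hh : 0 < h) (y : ℝ) : cutoff x h y ≤ 1 := by
  rw [cutoff, ramp, ramp, div_le_one hh]
  have : max (x + h - y) 0 ≤ max (x - y) 0 + h := by
    apply max_le
    · linarith [le_max_left (x - y) 0]
    · linarith [le_max_right (x - y) 0]
  linarith

lemma hasMellin_ramp_one {s : ℂ} (hs : 0 < s.re) :
    HasMellin (fun y => (ramp 1 y : ℂ)) s (1 / s - 1 / (s + 1)) := by
  have h1 := hasMellin_one_Ioc hs
  have h2 := hasMellin_cpow_Ioc 1 (s := s) (by simp; linarith)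
  have h3 := hasMellin_sub h1.1 h2.1
  rw [h1.2, h2.2] at h3
  have he : ∀ t ∈ Ioi (0 : ℝ), (ramp 1 t : ℂ) =
      indicator (Ioc 0 1) (fun _ => 1 : ℝ → ℂ) t -
        indicator (Ioc 0 1) (fun t => (t : ℂ) ^ (1 : ℂ) : ℝ → ℂ) t := by
    intro t ht
    rw [ramp]
    rcases le_or_gt t 1 with h | h
    · have hm : t ∈ Ioc (0 : ℝ) 1 := ⟨ht, h⟩
      rw [indicator_of_mem hm, indicator_of_mem hm, max_eq_left (by linarith)]
      simp
    · rw [indicator_of_notMem (fun h' => by linarith [h'.2]),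
        indicator_of_notMem (fun h' => by linarith [h'.2]), max_eq_right (by linarith)]
      simp
  refine ⟨?_, ?_⟩
  · refine (integrableOn_congr_fun (fun t ht => ?_) measurableSet_Ioi).1 h3.1
    simp only [he t ht]
  · rw [← h3.2]
    refine setIntegral_congr_fun measurableSet_Ioi fun t ht => ?_
    simp only [he t ht]

lemma hasMellin_ramp {a : ℝ} (ha : 0 < a) {s : ℂ} (hs : 0 < s.re) :
    HasMellin (fun y => (ramp a y : ℂ)) s ((a : ℂ) ^ (s + 1) / (s * (s + 1))) := by
  have h1 := hasMellin_ramp_one hs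
  have he : (fun y => (ramp a y : ℂ)) = fun y => (a : ℂ) • (ramp 1 (a⁻¹ * y) : ℂ) := by
    funext y
    rw [ramp, ramp, smul_eq_mul, ← ofReal_mul, mul_max_of_nonneg _ _ ha.le]
    congr 2
    · field_simp
    · simp
  have h2 := (MellinConvergent.comp_mul_left (f := fun y => (ramp 1 y : ℂ)) (s := s)
    (inv_pos.2 ha)).2 h1.1
  have h3 := mellin_comp_mul_left (fun y => (ramp 1 y : ℂ)) s (inv_pos.2 ha)
  have h4 := hasMellin_const_smul h2 (a : ℂ)
  rw [he]
  refine ⟨h4.1, ?_⟩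
  rw [h4.2, h3, h1.2]
  have hs0 : s ≠ 0 := by rintro rfl; simp at hs
  have hs1 : s + 1 ≠ 0 := by
    intro h; have := congrArg re h; simp at this; linarith
  have ha' : (a : ℂ) ≠ 0 := by exact_mod_cast ha.ne'
  rw [ofReal_inv, inv_cpow _ _ (by rw [arg_ofReal_of_nonneg ha.le]; exact Real.pi_pos.ne), cpow_neg,
    inv_inv, cpow_add _ _ ha', cpow_one, smul_eq_mul, smul_eq_mul]
  field_simp
  ring

lemma hasMellin_cutoff {x h : ℝ} (hx : 0 < x) (hh : 0 < h) {s : ℂ} (hs : 0 < s.re) :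
    HasMellin (fun y => (cutoff x h y : ℂ)) s (cutoffTransform x h s) := by
  have h1 := hasMellin_ramp (add_pos hx hh) hs
  have h2 := hasMellin_ramp hx hs
  have h3 := hasMellin_sub h1.1 h2.1
  rw [h1.2, h2.2] at h3
  have he : (fun y => (cutoff x h y : ℂ)) = fun y => ((ramp (x + h) y : ℂ) - ramp x y) / (h : ℂ) := by
    funext y; rw [cutoff]; push_cast; rfl
  rw [he]
  refine ⟨h3.1.div_const _, ?_⟩
  rw [mellin_div_const, h3.2, cutoffTransform]
  rw [← sub_div, div_div]
  congr 1
  ring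

lemma ne_zero_of_re_pos {s : ℂ} (hs : 0 < s.re) : s ≠ 0 := by rintro rfl; simp at hs

lemma norm_le_norm_add_one {s : ℂ} (hs : 0 ≤ s.re) : ‖s‖ ≤ ‖s + 1‖ := by
  rw [← sq_le_sq₀ (norm_nonneg _) (norm_nonneg _), Complex.sq_norm, Complex.sq_norm,
    normSq_apply, normSq_apply]
  simp; nlinarith

/-- Mean value inequality for `y ^ (s + 1)` on `[x, x + h]`. The factors `‖s + 1‖` and `h` cancel
against the denominator of the transform, leaving a bound without `1 / h`. -/
lemma norm_cpow_sub_cpow_le {x h : ℝ} (hx : 0 < x) (hh : 0 < h) {s : ℂ} (hs : 0 < s.re) :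
    ‖((x + h : ℝ) : ℂ) ^ (s + 1) - (x : ℂ) ^ (s + 1)‖ ≤ ‖s + 1‖ * (x + h) ^ s.re * h := by
  have hs1 : s + 1 ≠ 0 := ne_zero_of_re_pos (by simp; linarith)
  have := Convex.norm_image_sub_le_of_norm_hasDerivWithin_le
    (f := fun y : ℝ => (y : ℂ) ^ (s + 1)) (f' := fun y : ℝ => (s + 1) * (y : ℂ) ^ s)
    (s := Icc x (x + h)) (x := x) (y := x + h) (C := ‖s + 1‖ * (x + h) ^ s.re) ?_ ?_
    (convex_Icc _ _) ⟨le_rfl, by linarith⟩ ⟨by linarith, le_rfl⟩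
  · refine this.trans (le_of_eq ?_)
    rw [add_sub_cancel_left, Real.norm_of_nonneg hh.le]
  · intro y hy
    have hy0 : y ≠ 0 := by linarith [hy.1]
    have := hasDerivAt_ofReal_cpow_const' hy0 (r := s) (by
      intro h; rw [h] at hs; simp at hs; linarith)
    have := this.const_mul (s + 1)
    refine HasDerivAt.hasDerivWithinAt ?_
    refine HasDerivAt.congr_of_eventuallyEq (this.congr_deriv (by rfl)) ?_
    filter_upwards with z
    field_simp
  · intro y hy
    have hy0 : 0 < y := by linarith [hy.1]
    rw [norm_mul, norm_cpow_eq_rpow_re_of_pos hy0]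
    gcongr
    exact hy.2

lemma norm_cutoffTransform_le {x h : ℝ} (hx : 0 < x) (hh : 0 < h) {s : ℂ} (hs : 0 < s.re) :
    ‖cutoffTransform x h s‖ ≤ (x + h) ^ s.re / ‖s‖ := by
  have hs0 := norm_pos_iff.2 (ne_zero_of_re_pos hs)
  have hs1 := hs0.trans_le (norm_le_norm_add_one hs.le)
  rw [cutoffTransform, norm_div, norm_mul, norm_mul, norm_real, Real.norm_of_nonneg hh.le,
    div_le_div_iff₀ (by positivity) hs0]
  calc _ ≤ ‖s + 1‖ * (x + h) ^ s.re * h * ‖s‖ := by gcongr; exact norm_cpow_sub_cpow_le hx hh hs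
    _ = _ := by ring

/-- Here the two powers are bounded separately: a second factor `1 / ‖s‖` is gained at the price of
`(x + h) / h`. -/
lemma norm_cutoffTransform_le' {x h : ℝ} (hx : 0 < x) (hh : 0 < h) {s : ℂ} (hs : 0 < s.re) :
    ‖cutoffTransform x h s‖ ≤ (x + h) ^ s.re / ‖s‖ * (2 * ((x + h) / h) / ‖s‖) := by
  have hs0 := norm_pos_iff.2 (ne_zero_of_re_pos hs)
  have hle := norm_le_norm_add_one hs.le
  have hxh : 0 < x + h := by linarith
  rw [cutoffTransform, norm_div, norm_mul, norm_mul, norm_real, Real.norm_of_nonneg hh.le]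
  have h1 : ‖((x + h : ℝ) : ℂ) ^ (s + 1) - (x : ℂ) ^ (s + 1)‖ ≤ 2 * ((x + h) ^ s.re * (x + h)) := by
    refine (norm_sub_le _ _).trans ?_
    rw [norm_cpow_eq_rpow_re_of_pos hxh, norm_cpow_eq_rpow_re_of_pos hx, add_re, one_re,
      Real.rpow_add hxh, Real.rpow_add hx, Real.rpow_one, Real.rpow_one, two_mul]
    gcongr <;> linarith
  calc _ ≤ 2 * ((x + h) ^ s.re * (x + h)) / (h * (‖s‖ * ‖s‖)) := by gcongr
    _ = _ := by field_simp

/-- Interpolation between the trivial bound and the bound with quadratic decay. -/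
lemma norm_cutoffTransform_le_rpow {x h δ : ℝ} (hx : 0 < x) (hh : 0 < h) (hδ : 0 ≤ δ) (hδ1 : δ ≤ 1)
    {s : ℂ} (hs : 0 < s.re) :
    ‖cutoffTransform x h s‖ ≤ (x + h) ^ s.re / ‖s‖ * (2 * ((x + h) / h) / ‖s‖) ^ δ := by
  have hs0 := norm_pos_iff.2 (ne_zero_of_re_pos hs)
  have hxh : 0 < x + h := by linarith
  rcases le_total 1 (2 * ((x + h) / h) / ‖s‖) with h1 | h1
  · refine (norm_cutoffTransform_le hx hh hs).trans (le_mul_of_one_le_right (by positivity) ?_)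
    exact Real.one_le_rpow h1 hδ
  · refine (norm_cutoffTransform_le' hx hh hs).trans ?_
    gcongr
    have := Real.rpow_le_rpow_of_exponent_ge (by positivity) h1 hδ1
    rwa [Real.rpow_one] at this

lemma differentiableAt_cutoffTransform {x h : ℝ} (hx : 0 < x) (hh : 0 < h) {s : ℂ}
    (hs : 0 < s.re) : DifferentiableAt ℂ (cutoffTransform x h) s := by
  have h1 : ((x + h : ℝ) : ℂ) ≠ 0 := by exact_mod_cast (by linarith : x + h ≠ 0)
  have h2 : (x : ℂ) ≠ 0 := by exact_mod_cast hx.ne'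
  have h3 : (h : ℂ) ≠ 0 := by exact_mod_cast hh.ne'
  unfold cutoffTransform
  refine DifferentiableAt.fun_div (DifferentiableAt.fun_sub ?_ ?_) (by fun_prop) ?_
  · exact DifferentiableAt.const_cpow (by fun_prop) (Or.inl h1)
  · exact DifferentiableAt.const_cpow (by fun_prop) (Or.inl h2)
  · exact mul_ne_zero h3 (mul_ne_zero (ne_zero_of_re_pos hs)
      (ne_zero_of_re_pos (by simp; linarith)))

lemma mul_one_add_abs_im_le_norm {a : ℝ} (ha : 0 < a) (ha1 : a ≤ 1) {s : ℂ} (hs : a ≤ s.re) :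
    a / 2 * (1 + |s.im|) ≤ ‖s‖ := by
  have h1 := (le_abs_self _).trans (abs_re_le_norm s)
  have h2 := abs_im_le_norm s
  have := abs_nonneg s.im
  nlinarith

/-- Quadratic decay of the transform in a closed vertical strip. -/
lemma exists_norm_cutoffTransform_le {x h : ℝ} (hx : 1 ≤ x) (hh : 0 < h) {a b : ℝ} (ha : 0 < a)
    (ha1 : a ≤ 1) : ∃ A : ℝ, 0 ≤ A ∧ ∀ s : ℂ, a ≤ s.re → s.re ≤ b →
      ‖cutoffTransform x h s‖ ≤ A * (1 + |s.im|) ^ (-2 : ℝ) := by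
  refine ⟨(x + h) ^ b * (2 * ((x + h) / h)) / (a / 2) ^ 2, by positivity, fun s hs hs' => ?_⟩
  have hs0 : 0 < s.re := ha.trans_le hs
  have hxh : 1 ≤ x + h := by linarith
  refine (norm_cutoffTransform_le' (by linarith) hh hs0).trans ?_
  have h1 := mul_one_add_abs_im_le_norm ha ha1 hs
  have := abs_nonneg s.im
  rw [Real.rpow_neg (by positivity), Real.rpow_two]
  calc (x + h) ^ s.re / ‖s‖ * (2 * ((x + h) / h) / ‖s‖)
      ≤ (x + h) ^ b / (a / 2 * (1 + |s.im|)) * (2 * ((x + h) / h) / (a / 2 * (1 + |s.im|))) := by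
        gcongr
    _ = _ := by field_simp

lemma integrable_one_add_abs_rpow {r : ℝ} (hr : 1 < r) :
    Integrable fun t : ℝ => (1 + |t|) ^ (-r) := by
  have := integrable_one_add_norm (E := ℝ) (μ := volume) (r := r) (by simpa using hr)
  simpa only [Real.norm_eq_abs] using this

lemma continuous_cutoffTransform_vertical {x h : ℝ} (hx : 0 < x) (hh : 0 < h) {c : ℝ}
    (hc : 0 < c) : Continuous fun t : ℝ => cutoffTransform x h (c + t * I) := by
  rw [continuous_iff_continuousAt]
  intro t
  have := (differentiableAt_cutoffTransform hx hh (s := c + t * I) (by simpa using hc)).continuousAt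
  exact ContinuousAt.comp (f := fun t : ℝ => (c + t * I : ℂ)) this (by fun_prop)

lemma integrable_cutoffTransform_vertical {x h : ℝ} (hx : 1 ≤ x) (hh : 0 < h) {c : ℝ}
    (hc : 0 < c) : Integrable fun t : ℝ => cutoffTransform x h (c + t * I) := by
  obtain ⟨A, _, hA⟩ := exists_norm_cutoffTransform_le hx hh (a := min c 1) (b := c) (by positivity)
    (min_le_right _ _)
  refine ((integrable_one_add_abs_rpow (r := 2) (by norm_num)).const_mul A).mono'
    (continuous_cutoffTransform_vertical (by linarith) hh hc).aestronglyMeasurable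
    (Eventually.of_forall fun t => ?_)
  simpa using hA (c + t * I) (by simp) (by simp)

/-- Mellin inversion. The cutoff is continuous and its transform decays quadratically, so the
integral converges absolutely; a sharp cutoff would not allow this. -/
lemma integral_cutoffTransform_mul_cpow {x h : ℝ} (hx : 1 ≤ x) (hh : 0 < h) {c : ℝ} (hc : 0 < c)
    {y : ℝ} (hy : 0 < y) :
    ∫ t : ℝ, (y : ℂ) ^ (-(c + t * I : ℂ)) * cutoffTransform x h (c + t * I) =
      2 * Real.pi * cutoff x h y := by
  have he : ∀ t : ℝ, mellin (fun y => (cutoff x h y : ℂ)) (c + t * I) =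
      cutoffTransform x h (c + t * I) := fun t =>
    (hasMellin_cutoff (by linarith) hh (by simpa using hc)).2
  have h1 := mellinInv_mellin_eq c (fun y => (cutoff x h y : ℂ)) hy
    (hasMellin_cutoff (by linarith) hh (by simpa using hc)).1 (by
      unfold VerticalIntegrable
      simp only [he]
      exact integrable_cutoffTransform_vertical hx hh hc)
    ((continuous_ofReal.comp (continuous_cutoff x h)).continuousAt)
  unfold mellinInv at h1
  simp only [he, smul_eq_mul] at h1
  rw [← h1]
  have : (2 * Real.pi : ℂ) ≠ 0 := by exact_mod_cast Real.two_pi_pos.ne'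
  simp only [real_smul]
  push_cast
  rw [← mul_assoc, mul_one_div_cancel this, one_mul]

/-- The smoothed partial sums of a Dirichlet series as a vertical integral. -/
lemma hasSum_mul_cutoff {x h : ℝ} (hx : 1 ≤ x) (hh : 0 < h) {c : ℝ} (hc : 0 < c) {f : ℕ → ℂ}
    (hf0 : f 0 = 0) (hf : LSeriesSummable f c) :
    HasSum (fun n => 2 * Real.pi * (f n * cutoff x h n))
      (∫ t : ℝ, LSeries f (c + t * I) * cutoffTransform x h (c + t * I)) := by
  have hW := integrable_cutoffTransform_vertical hx hh hc
  -- The terms have constant modulus on the vertical line, so absolute convergence at `c` alone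
  -- justifies exchanging sum and integral.
  have hnorm : ∀ (n : ℕ) (t : ℝ), ‖LSeries.term f (c + t * I) n‖ = ‖LSeries.term f c n‖ := by
    intro n t
    rw [LSeries.norm_term_eq, LSeries.norm_term_eq]; simp
  have hterm : ∀ (n : ℕ), n ≠ 0 → ∀ t : ℝ, LSeries.term f (c + t * I) n =
      f n * (n : ℂ) ^ (-(c + t * I : ℂ)) := by
    intro n hn t
    rw [LSeries.term_of_ne_zero hn, cpow_neg, div_eq_mul_inv]
  have hmeas : ∀ n : ℕ, Continuous fun t : ℝ => LSeries.term f (c + t * I) n := by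
    intro n
    rcases eq_or_ne n 0 with rfl | hn
    · simpa using continuous_const
    · simp only [hterm n hn]
      refine continuous_const.mul (Continuous.const_cpow (by fun_prop) (Or.inl ?_))
      exact_mod_cast hn
  have hint : ∀ n : ℕ,
      Integrable fun t : ℝ => LSeries.term f (c + t * I) n * cutoffTransform x h (c + t * I) := by
    intro n
    refine hW.bdd_mul (c := ‖LSeries.term f c n‖) (hmeas n).aestronglyMeasurable
      (Eventually.of_forall fun t => (hnorm n t).le)
  have key := hasSum_integral_of_summable_integral_norm hint (by
    simp only [norm_mul, hnorm, integral_const_mul]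
    exact hf.norm.mul_right _)
  have e1 : (fun t : ℝ => ∑' n, LSeries.term f (c + t * I) n * cutoffTransform x h (c + t * I)) =
      fun t : ℝ => LSeries f (c + t * I) * cutoffTransform x h (c + t * I) := by
    funext t
    rw [tsum_mul_right, LSeries]
  rw [e1] at key
  refine (congrArg (HasSum · _) (funext fun n => ?_)).mp key
  rcases eq_or_ne n 0 with rfl | hn
  · simp [hf0]
  · simp only [hterm n hn, mul_assoc]
    rw [integral_const_mul]
    have := integral_cutoffTransform_mul_cpow hx hh hc (y := n) (by positivity)
    simp only [ofReal_natCast] at this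
    rw [this]; ring

/-- Shifting a vertical line of integration. -/
lemma integral_vertical_eq {H : ℂ → ℂ} {a b r C : ℝ} (hab : a ≤ b) (hr : 1 < r)
    (hH : ∀ s : ℂ, a ≤ s.re → s.re ≤ b → DifferentiableAt ℂ H s)
    (hb : ∀ s : ℂ, a ≤ s.re → s.re ≤ b → ‖H s‖ ≤ C * (1 + |s.im|) ^ (-r)) :
    ∫ t : ℝ, H (a + t * I) = ∫ t : ℝ, H (b + t * I) := by
  have hint : ∀ c : ℝ, a ≤ c → c ≤ b → Integrable fun t : ℝ => H (c + t * I) := by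
    intro c h1 h2
    refine ((integrable_one_add_abs_rpow hr).const_mul C).mono' ?_ (Eventually.of_forall fun t => ?_)
    · refine Continuous.aestronglyMeasurable (continuous_iff_continuousAt.2 fun t => ?_)
      exact ContinuousAt.comp (f := fun t : ℝ => (c + t * I : ℂ))
        (hH _ (by simpa using h1) (by simpa using h2)).continuousAt (by fun_prop)
    · simpa using hb (c + t * I) (by simpa using h1) (by simpa using h2)
  have hlim : ∀ c : ℝ, a ≤ c → c ≤ b → Tendsto (fun T : ℝ => ∫ t in (-T)..T, H (c + t * I)) atTop
      (𝓝 (∫ t : ℝ, H (c + t * I))) := fun c h1 h2 =>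
    intervalIntegral_tendsto_integral (hint c h1 h2) tendsto_neg_atTop_atBot tendsto_id
  -- The sign `e` treats the top and bottom sides of the rectangle together.
  have hhor : ∀ e : ℝ, |e| = 1 →
      Tendsto (fun T : ℝ => ∫ y in a..b, H (y + (e * T : ℝ) * I)) atTop (𝓝 0) := by
    intro e he
    have h0 : Tendsto (fun T : ℝ => C * (1 + |e * T|) ^ (-r) * |b - a|) atTop (𝓝 0) := by
      have h1 : Tendsto (fun T : ℝ => 1 + |e * T|) atTop atTop := by
        simp only [abs_mul, he, one_mul]
        exact tendsto_atTop_add_const_left _ _ tendsto_abs_atTop_atTop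
      have := ((tendsto_rpow_neg_atTop (by linarith : 0 < r)).comp h1).const_mul C
      simpa [Function.comp_def] using this.mul_const |b - a|
    refine squeeze_zero_norm (fun T => ?_) h0
    refine intervalIntegral.norm_integral_le_of_norm_le_const fun y hy => ?_
    rw [uIoc_of_le hab] at hy
    simpa using hb (y + (e * T : ℝ) * I) (by simpa using hy.1.le) (by simpa using hy.2)
  have hrect : ∀ T : ℝ, (∫ y in a..b, H (y + ((-1) * T : ℝ) * I)) -
      (∫ y in a..b, H (y + (1 * T : ℝ) * I)) + I * (∫ t in (-T)..T, H (b + t * I)) -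
      I * (∫ t in (-T)..T, H (a + t * I)) = 0 := by
    intro T
    have := integral_boundary_rect_eq_zero_of_differentiableOn H (a + (-T : ℝ) * I) (b + T * I) (by
      intro s hs
      rw [mem_reProdIm] at hs
      simp only [add_re, ofReal_re, mul_re, I_re, mul_zero, ofReal_im, I_im, mul_one, sub_self,
        add_zero] at hs
      rw [uIcc_of_le hab] at hs
      exact (hH s hs.1.1 hs.1.2).differentiableWithinAt)
    simpa using this
  have hl := (((hhor (-1) (by simp)).sub (hhor 1 (by simp))).add
    ((hlim b hab le_rfl).const_mul I)).sub ((hlim a le_rfl hab).const_mul I)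
  have h0 := tendsto_nhds_unique (hl.congr hrect) tendsto_const_nhds
  have h1 : I * ((∫ t : ℝ, H (a + t * I)) - ∫ t : ℝ, H (b + t * I)) = 0 := by
    linear_combination -h0
  exact sub_eq_zero.1 ((mul_eq_zero.1 h1).resolve_left I_ne_zero)

end ElkiesPrimes

end

/-! ### Weighted mean values on vertical lines, and the choice of `δ`. -/

section

open Complex Metric Set Filter Topology MeasureTheory

namespace ElkiesPrimes

lemma integral_one_add_abs_rpow {ε : ℝ} (hε : 0 < ε) :
    ∫ t : ℝ, (1 + |t|) ^ (-(1 + ε)) = 2 / ε := by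
  have hint := integrable_one_add_abs_rpow (r := 1 + ε) (by linarith)
  rw [integral_comp_abs (f := fun t => (1 + t) ^ (-(1 + ε)))]
  have h1 : IntegrableOn (fun t : ℝ => (1 + t) ^ (-(1 + ε))) (Ioi 0) :=
    (integrableOn_congr_fun (fun t ht => by rw [abs_of_pos ht]) measurableSet_Ioi).1
      hint.integrableOn
  have hd : ∀ t ∈ Ici (0 : ℝ), HasDerivAt (fun t : ℝ => -((1 + t) ^ (-ε) / ε))
      ((1 + t) ^ (-(1 + ε))) t := by
    intro t ht
    have ht' : 0 ≤ t := ht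
    have := ((((hasDerivAt_id t).const_add 1).rpow_const (p := -ε) (Or.inl (by
      simp only [id]; linarith))).div_const ε).fun_neg
    refine this.congr_deriv ?_
    simp only [id]
    rw [show -ε - 1 = -(1 + ε) by ring]
    field_simp
  have ht : Tendsto (fun t : ℝ => -((1 + t) ^ (-ε) / ε)) atTop (𝓝 0) := by
    have h2 : Tendsto (fun t : ℝ => 1 + t) atTop atTop := tendsto_atTop_add_const_left _ _ tendsto_id
    have := (((tendsto_rpow_neg_atTop hε).comp h2).div_const ε).neg
    simpa [Function.comp_def] using this
  rw [integral_Ioi_of_hasDerivAt_of_tendsto' hd h1 ht]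
  simp
  ring

/-- If the averages of `G` over segments of length one are bounded by `B`, then the mean value of
`G` against a slowly varying weight is bounded by that of `B`. -/
lemma integral_mul_le_of_average {G φ B : ℝ → ℝ} {c : ℝ} (hc : 0 ≤ c) (hGc : Continuous G)
    (hφc : Continuous φ) (hG0 : ∀ t, 0 ≤ G t) (hφ0 : ∀ t, 0 ≤ φ t)
    (hloc : ∀ u, ∫ t in (u - 1 / 2)..(u + 1 / 2), G t ≤ B u)
    (hφ : ∀ t u, |t - u| ≤ 1 / 2 → φ t ≤ c * φ u) (hint : Integrable fun u => φ u * B u) :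
    Integrable (fun t => G t * φ t) ∧ ∫ t, G t * φ t ≤ c * ∫ u, φ u * B u := by
  have hB0 : ∀ u, 0 ≤ B u := fun u =>
    (intervalIntegral.integral_nonneg (by linarith) fun t _ => hG0 t).trans (hloc u)
  -- Tonelli on the strip `|t - u| ≤ 1/2`. Integrating over `u` first dominates `G t * φ t`, because
  -- the slice has length one; integrating over `t` first produces the local averages. Extended
  -- nonnegative integrals yield integrability along with the bound.
  set K : ℝ → ℝ → ENNReal := fun t u => if |t - u| ≤ 1 / 2 then ENNReal.ofReal (c * (G t * φ u)) else 0
    with hK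
  have hKm : Measurable (Function.uncurry K) := by
    refine Measurable.ite ?_ ?_ measurable_const
    · exact measurableSet_le (by fun_prop) measurable_const
    · refine ENNReal.measurable_ofReal.comp (Continuous.measurable ?_)
      fun_prop
  have hIcc : ∀ t : ℝ, {u | |t - u| ≤ 1 / 2} = Icc (t - 1 / 2) (t + 1 / 2) := by
    intro t; ext u; simp only [mem_ofPred_eq, mem_Icc, abs_le]
    constructor <;> rintro ⟨h1, h2⟩ <;> constructor <;> linarith
  have hIcc' : ∀ u : ℝ, {t | |t - u| ≤ 1 / 2} = Icc (u - 1 / 2) (u + 1 / 2) := by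
    intro t; ext u; simp only [mem_ofPred_eq, mem_Icc, abs_le]
    constructor <;> rintro ⟨h1, h2⟩ <;> constructor <;> linarith
  have hle : ∫⁻ t, ENNReal.ofReal (G t * φ t) ≤ ENNReal.ofReal (c * ∫ u, φ u * B u) := by
    calc ∫⁻ t, ENNReal.ofReal (G t * φ t) ≤ ∫⁻ t, ∫⁻ u, K t u := by
          refine lintegral_mono fun t => ?_
          have e1 : ∫⁻ u, K t u =
              ∫⁻ u in Icc (t - 1 / 2) (t + 1 / 2), ENNReal.ofReal (c * (G t * φ u)) := by
            rw [← lintegral_indicator measurableSet_Icc, ← hIcc]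
            rfl
          rw [e1]
          have e2 : ENNReal.ofReal (G t * φ t) =
              ∫⁻ u in Icc (t - 1 / 2) (t + 1 / 2), ENNReal.ofReal (G t * φ t) := by
            rw [setLIntegral_const, Real.volume_Icc]; norm_num
          rw [e2]
          refine setLIntegral_mono' measurableSet_Icc fun u hu => ENNReal.ofReal_le_ofReal ?_
          rw [← hIcc] at hu
          calc G t * φ t ≤ G t * (c * φ u) := mul_le_mul_of_nonneg_left (hφ t u hu) (hG0 t)
            _ = _ := by ring
      _ = ∫⁻ u, ∫⁻ t, K t u := lintegral_lintegral_swap hKm.aemeasurable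
      _ ≤ ∫⁻ u, ENNReal.ofReal (c * (φ u * B u)) := by
          refine lintegral_mono fun u => ?_
          have e1 : ∫⁻ t, K t u =
              ∫⁻ t in Icc (u - 1 / 2) (u + 1 / 2), ENNReal.ofReal (c * (G t * φ u)) := by
            rw [← lintegral_indicator measurableSet_Icc, ← hIcc']
            rfl
          have e2 : Continuous fun t => c * (G t * φ u) := by fun_prop
          rw [e1, ← ofReal_integral_eq_lintegral_ofReal e2.integrableOn_Icc
            (Eventually.of_forall fun t => mul_nonneg hc (mul_nonneg (hG0 t) (hφ0 u)))]
          refine ENNReal.ofReal_le_ofReal ?_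
          rw [integral_const_mul, integral_mul_const, integral_Icc_eq_integral_Ioc,
            ← intervalIntegral.integral_of_le (by linarith), mul_comm (φ u)]
          have := hφ0 u
          gcongr
          exact hloc u
      _ = ENNReal.ofReal (c * ∫ u, φ u * B u) := by
          rw [← integral_const_mul, ← ofReal_integral_eq_lintegral_ofReal (hint.const_mul c)
            (Eventually.of_forall fun t => mul_nonneg hc (mul_nonneg (hφ0 t) (hB0 t)))]
  have hmeas : AEStronglyMeasurable (fun t => G t * φ t) volume :=
    (hGc.mul hφc).aestronglyMeasurable
  have hnn : ∀ t, 0 ≤ G t * φ t := fun t => mul_nonneg (hG0 t) (hφ0 t)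
  refine ⟨⟨hmeas, ?_⟩, ?_⟩
  · rw [hasFiniteIntegral_iff_ofReal (Eventually.of_forall hnn)]
    exact hle.trans_lt ENNReal.ofReal_lt_top
  · rw [integral_eq_lintegral_of_nonneg_ae (Eventually.of_forall hnn) hmeas]
    refine ENNReal.toReal_le_of_le_ofReal ?_ hle
    exact mul_nonneg hc (integral_nonneg fun u => mul_nonneg (hφ0 u) (hB0 u))

lemma logConductor_le {m : ℕ} (hm : 1 ≤ m) {ε : ℝ} (hε : 0 < ε) (t : ℝ) :
    logConductor m t ≤ (Real.log (2 * m) + 1 / ε) * (1 + |t|) ^ ε := by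
  have hm' : (1 : ℝ) ≤ m := by exact_mod_cast hm
  have ht := abs_nonneg t
  have h1 : logConductor m t ≤ Real.log (2 * m) + Real.log (1 + |t|) := by
    rw [logConductor, ← Real.log_mul (by positivity) (by positivity)]
    exact Real.log_le_log (by positivity) (by nlinarith)
  have h2 := Real.log_le_rpow_div (x := 1 + |t|) (by positivity) hε
  have h3 : 1 ≤ (1 + |t|) ^ ε := Real.one_le_rpow (by linarith) hε.le
  have h4 : 0 ≤ Real.log (2 * m) := Real.log_nonneg (by linarith)
  calc _ ≤ Real.log (2 * m) * 1 + (1 + |t|) ^ ε / ε := by linarith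
    _ ≤ Real.log (2 * m) * (1 + |t|) ^ ε + (1 + |t|) ^ ε / ε := by gcongr
    _ = _ := by ring

/-- The mean value of the conductor against a weight barely integrable at infinity. -/
lemma integral_rpow_mul_logConductor_le {m : ℕ} (hm : 1 ≤ m) {δ : ℝ} (hδ : 0 < δ) :
    Integrable (fun t : ℝ => (1 + |t|) ^ (-(1 + δ)) * logConductor m t) ∧
    ∫ t : ℝ, (1 + |t|) ^ (-(1 + δ)) * logConductor m t ≤
      4 / δ * (Real.log (2 * m) + 2 / δ) := by
  -- Half of the surplus exponent absorbs the logarithm, the other half keeps the integral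
  -- convergent.
  have hpt : ∀ t : ℝ, (1 + |t|) ^ (-(1 + δ)) * logConductor m t ≤
      (Real.log (2 * m) + 2 / δ) * (1 + |t|) ^ (-(1 + δ / 2)) := by
    intro t
    have ht := abs_nonneg t
    have h1 := logConductor_le hm (half_pos hδ) t
    calc _ ≤ (1 + |t|) ^ (-(1 + δ)) * ((Real.log (2 * m) + 1 / (δ / 2)) * (1 + |t|) ^ (δ / 2)) := by
          gcongr
      _ = (Real.log (2 * m) + 2 / δ) * ((1 + |t|) ^ (-(1 + δ)) * (1 + |t|) ^ (δ / 2)) := by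
          rw [one_div_div]; ring
      _ = _ := by
          rw [← Real.rpow_add (by positivity)]
          ring_nf
  have hint := (integrable_one_add_abs_rpow (r := 1 + δ / 2) (by linarith)).const_mul
    (Real.log (2 * m) + 2 / δ)
  have hm' : (1 : ℝ) ≤ m := by exact_mod_cast hm
  have hnn : ∀ t : ℝ, 0 ≤ (1 + |t|) ^ (-(1 + δ)) * logConductor m t := by
    intro t
    have ht := abs_nonneg t
    refine mul_nonneg (by positivity) (Real.log_nonneg (by nlinarith))
  have hcont : Continuous fun t : ℝ => (1 + |t|) ^ (-(1 + δ)) * logConductor m t := by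
    unfold logConductor
    refine Continuous.mul ?_ ?_
    · exact Continuous.rpow_const (by fun_prop) fun t => Or.inl (by positivity)
    · exact Continuous.log (by fun_prop) fun t => by positivity
  have hI : Integrable (fun t : ℝ => (1 + |t|) ^ (-(1 + δ)) * logConductor m t) :=
    hint.mono' hcont.aestronglyMeasurable (Eventually.of_forall fun t => by
      rw [Real.norm_of_nonneg (hnn t)]; exact hpt t)
  refine ⟨hI, (integral_mono hI hint hpt).trans (le_of_eq ?_)⟩
  rw [integral_const_mul, integral_one_add_abs_rpow (half_pos hδ)]
  field_simp
  ring

/-- Supplies the slow variation of the weight in `integral_mul_le_of_average`: `1 + |u| ≤ 2 (1 +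
|t|)`, and `2 ^ r ≤ 4`. -/
lemma one_add_abs_rpow_le {r : ℝ} (hr0 : 0 ≤ r) (hr : r ≤ 2) {t u : ℝ} (h : |t - u| ≤ 1 / 2) :
    (1 + |t|) ^ (-r) ≤ 4 * (1 + |u|) ^ (-r) := by
  have ht := abs_nonneg t
  have hu := abs_nonneg u
  have h1 : |u| ≤ |t| + 1 / 2 := by
    have := abs_sub_abs_le_abs_sub u t
    rw [abs_sub_comm] at this
    linarith
  have h2 : (1 + |u|) ^ r ≤ 4 * (1 + |t|) ^ r := by
    calc (1 + |u|) ^ r ≤ (2 * (1 + |t|)) ^ r := by gcongr; linarith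
      _ = 2 ^ r * (1 + |t|) ^ r := Real.mul_rpow (by norm_num) (by positivity)
      _ ≤ 2 ^ (2 : ℝ) * (1 + |t|) ^ r := by gcongr; norm_num
      _ = _ := by norm_num
  rw [Real.rpow_neg (by positivity), Real.rpow_neg (by positivity), ← div_eq_mul_inv,
    le_div_iff₀ (by positivity), inv_mul_le_iff₀ (by positivity)]
  linarith

/-- The exponent `1 / (2 log x)`. -/
noncomputable def shift (x : ℝ) : ℝ := 1 / (2 * Real.log x)

lemma shift_pos {x : ℝ} (hx : 2 ≤ x) : 0 < shift x := by
  have := Real.log_pos (by linarith : 1 < x)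
  unfold shift; positivity

lemma shift_le {x : ℝ} (hx : 2 ≤ x) : shift x ≤ 3 / 4 := by
  have h1 := Real.log_le_log (by norm_num) hx
  have := Real.log_two_gt_d9
  unfold shift
  rw [div_le_div_iff₀ (by linarith) (by norm_num)]
  linarith

lemma rpow_shift {x : ℝ} (hx : 2 ≤ x) : x ^ shift x = Real.exp (1 / 2) := by
  have := Real.log_pos (by linarith : 1 < x)
  rw [Real.rpow_def_of_pos (by linarith), shift]
  congr 1
  field_simp

lemma add_sqrt_le {x : ℝ} (hx : 1 ≤ x) : x + √x ≤ 2 * x := by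
  have := Real.sqrt_le_sqrt hx
  have h2 := Real.mul_self_sqrt (by linarith : 0 ≤ x)
  rw [Real.sqrt_one] at this
  nlinarith

/-- Decay of the transform of the cutoff on `[x, x + √x]`, with constants uniform in `x`. -/
lemma norm_cutoffTransform_sqrt_le {x a : ℝ} (hx : 2 ≤ x) (ha : 0 < a) (ha1 : a ≤ 1)
    (hxa : 1 / a ≤ 2 * x) {s : ℂ} (hs : a ≤ s.re) :
    ‖cutoffTransform x √x s‖ ≤
      (2 * x) ^ s.re * (2 / a) * Real.exp 3 * (1 + |s.im|) ^ (-(1 + shift x)) := by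
  have hx0 : 0 < x := by linarith
  have hsq : 0 < √x := Real.sqrt_pos.2 hx0
  have hs0 : 0 < s.re := ha.trans_le hs
  have hδ := shift_pos hx
  have him := abs_nonneg s.im
  have hnorm := mul_one_add_abs_im_le_norm ha ha1 hs
  refine (norm_cutoffTransform_le_rpow hx0 hsq hδ.le ((shift_le hx).trans (by norm_num)) hs0).trans ?_
  have hq : (x + √x) / √x ≤ 2 * x := by
    rw [div_le_iff₀ hsq]
    have h1 : 1 ≤ √x := by rw [Real.one_le_sqrt]; linarith
    have := add_sqrt_le (by linarith : 1 ≤ x)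
    nlinarith
  -- A crude power of `x` is harmless: raised to the power `shift x` it becomes the constant `exp
  -- 3`.
  have hbase : 2 * ((x + √x) / √x) / ‖s‖ ≤ x ^ 6 * (1 + |s.im|)⁻¹ := by
    calc 2 * ((x + √x) / √x) / ‖s‖ ≤ 2 * (2 * x) / (a / 2 * (1 + |s.im|)) := by gcongr
      _ = 8 * x * (1 / a) * (1 + |s.im|)⁻¹ := by field_simp; ring
      _ ≤ 8 * x * (2 * x) * (1 + |s.im|)⁻¹ := by gcongr
      _ ≤ x ^ 6 * (1 + |s.im|)⁻¹ := by
          gcongr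
          have h4 : (2 : ℝ) ^ 4 ≤ x ^ 4 := by gcongr
          nlinarith [sq_nonneg x]
  calc (x + √x) ^ s.re / ‖s‖ * (2 * ((x + √x) / √x) / ‖s‖) ^ shift x
      ≤ (2 * x) ^ s.re / (a / 2 * (1 + |s.im|)) * (x ^ 6 * (1 + |s.im|)⁻¹) ^ shift x := by
        gcongr
        exact add_sqrt_le (by linarith)
    _ = (2 * x) ^ s.re * (2 / a) * (x ^ shift x) ^ 6 *
        ((1 + |s.im|)⁻¹ * ((1 + |s.im|)⁻¹) ^ shift x) := by
        have e1 : (x ^ 6) ^ shift x = (x ^ shift x) ^ 6 := by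
          rw [← Real.rpow_natCast_mul hx0.le, ← Real.rpow_mul_natCast hx0.le, mul_comm]
        rw [Real.mul_rpow (x := x ^ 6) (by positivity) (by positivity), e1]
        field_simp
    _ = (2 * x) ^ s.re * (2 / a) * Real.exp 3 * (1 + |s.im|) ^ (-(1 + shift x)) := by
        rw [rpow_shift hx, ← Real.exp_nat_mul, Real.inv_rpow (by positivity), ← Real.rpow_neg (by positivity),
          neg_add, Real.rpow_add (by positivity), Real.rpow_neg_one]
        norm_num

end ElkiesPrimes

end

/-! ### The smoothed sum of `χ Λ` under GRH. -/

section

open Complex Metric Set Filter Topology MeasureTheory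

namespace ElkiesPrimes

variable {m : ℕ} {χ : DirichletCharacter ℂ m}

/-- Since `1 / shift x = 2 log x`, the mean value of the conductor against the weight costs exactly
two logarithms. -/
lemma log_two_mul_add_le (hm : 2 ≤ m) {x : ℝ} (hx : 2 ≤ x) :
    1 / shift x * (Real.log (2 * m) + 2 / shift x) ≤ 10 * Real.log (m * x) ^ 2 := by
  have hm' : (2 : ℝ) ≤ m := by exact_mod_cast hm
  have hlx := Real.log_pos (by linarith : 1 < x)
  have hlm := Real.log_pos (by linarith : 1 < (m : ℝ))
  have h2 : Real.log 2 ≤ Real.log m := Real.log_le_log (by norm_num) hm'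
  have h2' : Real.log 2 ≤ Real.log x := Real.log_le_log (by norm_num) hx
  unfold shift
  rw [one_div_one_div, div_div_eq_mul_div, div_one, Real.log_mul (by norm_num) (by positivity),
    Real.log_mul (by positivity) (by positivity)]
  nlinarith [mul_pos hlx hlm]

/-- Used only for integrability and for moving contours, so the dependence of `C` on all parameters
does no harm. Half a power of the quadratic decay pays for the logarithm. -/
lemma exists_norm_logDeriv_mul_cutoffTransform_le (hm : 1 ≤ m) {x h : ℝ} (hx : 1 ≤ x) (hh : 0 < h)
    {a b : ℝ} (ha : 0 < a) (ha1 : a ≤ 1) (K : ℝ) (hK : 0 ≤ K) : ∃ C : ℝ, ∀ s : ℂ, ∀ z : ℂ,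
      a ≤ s.re → s.re ≤ b → ‖z‖ ≤ K * logConductor m s.im →
        ‖z * cutoffTransform x h s‖ ≤ C * (1 + |s.im|) ^ (-(3 / 2 : ℝ)) := by
  obtain ⟨A, hA0, hA⟩ := exists_norm_cutoffTransform_le hx hh (b := b) ha ha1
  refine ⟨K * (Real.log (2 * m) + 1 / (1 / 2)) * A, fun s z h1 h2 hz => ?_⟩
  have h3 := logConductor_le hm (by norm_num : (0 : ℝ) < 1 / 2) s.im
  have h4 := hA s h1 h2
  have hlog : 0 ≤ Real.log (2 * m) := Real.log_nonneg (by
    have : (1 : ℝ) ≤ m := by exact_mod_cast hm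
    linarith)
  rw [norm_mul]
  calc ‖z‖ * ‖cutoffTransform x h s‖
      ≤ (K * ((Real.log (2 * m) + 1 / (1 / 2)) * (1 + |s.im|) ^ (1 / 2 : ℝ))) *
        (A * (1 + |s.im|) ^ (-2 : ℝ)) := by
        gcongr
        exact hz.trans (by gcongr)
    _ = K * (Real.log (2 * m) + 1 / (1 / 2)) * A *
        ((1 + |s.im|) ^ (1 / 2 : ℝ) * (1 + |s.im|) ^ (-2 : ℝ)) := by ring
    _ = _ := by
        rw [← Real.rpow_add (by positivity)]
        norm_num

variable [NeZero m]

lemma differentiableAt_logDeriv_LFunction (hGRH : GRH) (hχ : χ ≠ 1) {s : ℂ} (hs : 1 / 2 < s.re) :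
    DifferentiableAt ℂ (fun s => deriv χ.LFunction s / χ.LFunction s) s := by
  have hd := DirichletCharacter.differentiable_LFunction hχ
  have hd' : Differentiable ℂ (deriv χ.LFunction) := hd.contDiff.differentiable_deriv_two
  exact (hd' s).fun_div (hd s) (LFunction_ne_zero_of_half_lt_re hGRH hχ hs)

lemma norm_logDeriv_LFunction_le_of_ge (hGRH : GRH) (hχ : χ ≠ 1) {η : ℝ} (hη : 0 < η) {s : ℂ}
    (h1 : 1 / 2 + η ≤ s.re) (h2 : s.re ≤ 2) :
    ‖deriv χ.LFunction s / χ.LFunction s‖ ≤ 40000 / η * logConductor m s.im := by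
  have := one_le_logConductor (two_le_modulus hχ) s.im
  refine (norm_logDeriv_LFunction_le hGRH hχ (by linarith) h2).trans ?_
  rw [div_mul_eq_mul_div]
  gcongr
  linarith

/-- The smoothed sum of `χ Λ` is a vertical integral close to the critical line. -/
lemma hasSum_character_mul_vonMangoldt (hGRH : GRH) (hχ : χ ≠ 1) {x h σ : ℝ} (hx : 1 ≤ x)
    (hh : 0 < h) (hσ : 1 / 2 < σ) (hσ2 : σ ≤ 2) :
    HasSum (fun n : ℕ => 2 * Real.pi *
        (χ (n : ZMod m) * (ArithmeticFunction.vonMangoldt n : ℂ) * cutoff x h n))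
      (-∫ t : ℝ, deriv χ.LFunction (σ + t * I) / χ.LFunction (σ + t * I) *
        cutoffTransform x h (σ + t * I)) := by
  have h1 := hasSum_mul_cutoff hx hh (c := 2) (by norm_num)
    (f := (fun n : ℕ => χ (n : ZMod m)) * fun n => (ArithmeticFunction.vonMangoldt n : ℂ)) (by simp)
    (DirichletCharacter.LSeriesSummable_twist_vonMangoldt χ (by simp))
  obtain ⟨C, hC⟩ := exists_norm_logDeriv_mul_cutoffTransform_le (m := m)
    (by have := two_le_modulus hχ; omega) hx hh (a := 1 / 2) (b := 2) (by norm_num) (by norm_num)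
    (40000 / (σ - 1 / 2)) (div_nonneg (by norm_num) (by linarith))
  have h2 := integral_vertical_eq (r := 3 / 2) (C := C)
    (H := fun s => deriv χ.LFunction s / χ.LFunction s * cutoffTransform x h s) hσ2 (by norm_num)
    (fun s hs _ => (differentiableAt_logDeriv_LFunction hGRH hχ (by linarith)).fun_mul
      (differentiableAt_cutoffTransform (by linarith) hh (by linarith)))
    (fun s hs hs' => hC s _ (by linarith) hs'
      (norm_logDeriv_LFunction_le_of_ge hGRH hχ (by linarith) (by linarith) hs'))
  rw [h2, ← integral_neg]
  refine (congrArg (HasSum _) (integral_congr_ae (Eventually.of_forall fun t => ?_))).mp h1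
  have ht : 1 < ((2 : ℝ) + t * I : ℂ).re := by simp
  rw [DirichletCharacter.LSeries_twist_vonMangoldt_eq χ ht,
    DirichletCharacter.LFunction_eq_LSeries χ ht,
    DirichletCharacter.deriv_LFunction_eq_deriv_LSeries χ ht]
  ring

/-- The conjugate of `L'/L` contributes little, its contour being moved to the left. -/
lemma norm_integral_conj_logDeriv_le (hGRH : GRH) (hχ : χ ≠ 1) {x : ℝ} (hx : 2 ≤ x) :
    ‖∫ t : ℝ, (starRingEnd ℂ) (deriv χ.LFunction ((1 / 2 + shift x : ℝ) + t * I) /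
        χ.LFunction ((1 / 2 + shift x : ℝ) + t * I)) *
        cutoffTransform x √x ((1 / 2 + shift x : ℝ) + t * I)‖ ≤
      10 ^ 8 * Real.exp 4 * Real.log x * Real.log (m * x) ^ 2 := by
  have hm := two_le_modulus hχ
  have hδ := shift_pos hx
  have hδ' := shift_le hx
  have hx0 : 0 < x := by linarith
  have hlx := Real.log_pos (by linarith : 1 < x)
  have hsq : 0 < √x := Real.sqrt_pos.2 hx0
  set δ := shift x with hδdef
  set E : ℂ → ℂ := fun w => deriv χ.LFunction w / χ.LFunction w with hE
  -- The reflection `s ↦ 1 + 2δ - conj s` fixes the line `Re s = 1/2 + δ`, and the two conjugations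
  -- make `H` holomorphic. Moving `s` left moves the argument of `E` right, away from the zeros.
  set H : ℂ → ℂ := fun s => (starRingEnd ℂ) (E ((1 + 2 * δ : ℝ) - (starRingEnd ℂ) s)) *
    cutoffTransform x √x s with hH
  have hre : ∀ s : ℂ, (((1 + 2 * δ : ℝ) : ℂ) - (starRingEnd ℂ) s).re = 1 + 2 * δ - s.re := by
    intro s; rw [sub_re, conj_re, ofReal_re]
  have him : ∀ s : ℂ, (((1 + 2 * δ : ℝ) : ℂ) - (starRingEnd ℂ) s).im = s.im := by
    intro s; rw [sub_im, conj_im, ofReal_im]; ring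
  have hEd : ∀ s : ℂ, s.re ≤ 1 / 2 + δ →
      DifferentiableAt ℂ (fun s => (starRingEnd ℂ) (E ((1 + 2 * δ : ℝ) - (starRingEnd ℂ) s))) s := by
    intro s hs
    have h1 : DifferentiableAt ℂ (fun w => E ((1 + 2 * δ : ℝ) - w)) ((starRingEnd ℂ) s) := by
      have h2 : DifferentiableAt ℂ E ((1 + 2 * δ : ℝ) - (starRingEnd ℂ) s) :=
        differentiableAt_logDeriv_LFunction hGRH hχ (by rw [hre]; linarith)
      exact DifferentiableAt.comp (g := E) (f := fun w => ((1 + 2 * δ : ℝ) : ℂ) - w) _ h2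
        (by fun_prop)
    have := h1.conj_conj
    rw [conj_conj] at this
    exact this
  obtain ⟨C, hC⟩ := exists_norm_logDeriv_mul_cutoffTransform_le (m := m)
    (by omega) (by linarith : 1 ≤ x) hsq (a := δ) (b := 1 / 2 + δ) hδ (by linarith)
    (40000 / δ) (by positivity)
  have h1 := integral_vertical_eq (H := H) (r := 3 / 2) (C := C) (a := δ) (b := 1 / 2 + δ)
    (by linarith) (by norm_num)
    (fun s hs hs' => (hEd s hs').fun_mul
      (differentiableAt_cutoffTransform hx0 hsq (by linarith)))
    (fun s hs hs' => hC s _ hs hs' (by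
      rw [norm_conj, ← him s]
      exact norm_logDeriv_LFunction_le_of_ge hGRH hχ hδ (by rw [hre]; linarith)
        (by rw [hre]; linarith)))
  have h2 : ∀ t : ℝ, H ((1 / 2 + δ : ℝ) + t * I) =
      (starRingEnd ℂ) (E ((1 / 2 + δ : ℝ) + t * I)) *
        cutoffTransform x √x ((1 / 2 + δ : ℝ) + t * I) := by
    intro t
    simp only [hH]
    congr 3
    simp only [map_add, map_mul, conj_ofReal, conj_I]
    push_cast
    ring
  simp only [h2] at h1
  rw [← h1]
  obtain ⟨hi1, hi2⟩ := integral_rpow_mul_logConductor_le (m := m) (by omega) hδ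
  have hi3 := hi1.const_mul (80000 * ((2 * x) ^ δ * (2 / δ) * Real.exp 3))
  refine (norm_integral_le_of_norm_le hi3 (Eventually.of_forall fun t => ?_)).trans ?_
  · have hs : ((δ : ℂ) + t * I).re = δ := by simp
    have hs' : ((δ : ℂ) + t * I).im = t := by simp
    simp only [hH]
    rw [norm_mul, norm_conj]
    -- On the new line `E` is evaluated at real part `1 + δ`, at distance at least `1/2` from the
    -- critical line, so no factor `1 / δ` arises from it.
    have e1 := norm_logDeriv_LFunction_le_of_ge (s := (1 + 2 * δ : ℝ) - (starRingEnd ℂ) (δ + t * I))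
      hGRH hχ (η := 1 / 2) (by norm_num) (by rw [hre, hs]; linarith) (by rw [hre, hs]; linarith)
    rw [him, hs'] at e1
    have e2 := norm_cutoffTransform_sqrt_le (s := δ + t * I) hx hδ (by linarith) (by
      rw [hδdef, shift, one_div_one_div]
      have := Real.log_le_sub_one_of_pos hx0
      linarith) hs.ge
    rw [hs, hs'] at e2
    have hL := one_le_logConductor hm t
    calc _ ≤ (40000 / (1 / 2) * logConductor m t) *
          ((2 * x) ^ δ * (2 / δ) * Real.exp 3 * (1 + |t|) ^ (-(1 + δ))) := by gcongr
      _ = _ := by ring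
  · rw [integral_const_mul]
    have e1 : (2 * x) ^ δ ≤ Real.exp 1 := by
      calc (2 * x) ^ δ ≤ (x ^ 2) ^ δ := by gcongr; nlinarith
        _ = (x ^ δ) ^ 2 := by
          rw [← Real.rpow_natCast_mul hx0.le, ← Real.rpow_mul_natCast hx0.le, mul_comm]
        _ = Real.exp 1 := by rw [hδdef, rpow_shift hx, ← Real.exp_nat_mul]; norm_num
    have e2 := log_two_mul_add_le hm hx
    rw [← hδdef] at e2
    have e3 : 1 / δ = 2 * Real.log x := by rw [hδdef, shift, one_div_one_div]
    have e4 : Real.exp 4 = Real.exp 1 * Real.exp 3 := by rw [← Real.exp_add]; norm_num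
    have e5 : 0 ≤ ∫ t : ℝ, (1 + |t|) ^ (-(1 + δ)) * logConductor m t :=
      integral_nonneg fun t => by
        have := one_le_logConductor hm t
        positivity
    calc _ ≤ 80000 * (Real.exp 1 * (2 / δ) * Real.exp 3) * (4 / δ * (Real.log (2 * m) + 2 / δ)) := by
          gcongr
      _ = 640000 * Real.exp 4 * (1 / δ) * (1 / δ * (Real.log (2 * m) + 2 / δ)) := by
          rw [e4]; ring
      _ ≤ 640000 * Real.exp 4 * (1 / δ) * (10 * Real.log (m * x) ^ 2) := by gcongr
      _ = 12800000 * (Real.exp 4 * Real.log x * Real.log (m * x) ^ 2) := by rw [e3]; ring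
      _ ≤ 10 ^ 8 * (Real.exp 4 * Real.log x * Real.log (m * x) ^ 2) := by gcongr; norm_num
      _ = _ := by ring

lemma integral_abs_re_logDeriv_mul_le (hGRH : GRH) (hχ : χ ≠ 1) {x : ℝ} (hx : 2 ≤ x) :
    ‖∫ t : ℝ, (((deriv χ.LFunction ((1 / 2 + shift x : ℝ) + t * I) /
        χ.LFunction ((1 / 2 + shift x : ℝ) + t * I)).re : ℝ) : ℂ) *
        cutoffTransform x √x ((1 / 2 + shift x : ℝ) + t * I)‖ ≤
      10 ^ 8 * Real.exp 4 * √x * Real.log (m * x) ^ 2 := by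
  have hm := two_le_modulus hχ
  have hδ := shift_pos hx
  have hδ' := shift_le hx
  have hx0 : 0 < x := by linarith
  set δ := shift x with hδdef
  have hE := continuous_logDeriv_LFunction_vertical hGRH hχ (σ := 1 / 2 + δ) (by linarith)
  obtain ⟨hi1, hi2⟩ := integral_rpow_mul_logConductor_le (m := m) (by omega) hδ
  obtain ⟨hj1, hj2⟩ := integral_mul_le_of_average (c := 4)
    (G := fun t : ℝ => |(deriv χ.LFunction ((1 / 2 + δ : ℝ) + t * I) /
        χ.LFunction ((1 / 2 + δ : ℝ) + t * I)).re|)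
    (φ := fun t : ℝ => (1 + |t|) ^ (-(1 + δ))) (B := fun t => 21000 * logConductor m t)
    (by norm_num) (continuous_re.comp hE).abs
    (Continuous.rpow_const (by fun_prop) fun t => Or.inl (by positivity))
    -- The next argument is the local mean bound for `|Re L'/L|`, which holds with no loss in `δ`.
    (fun t => abs_nonneg _) (fun t => by positivity)
    (fun u => integral_abs_re_logDeriv_le hGRH hχ (by linarith) (by linarith) u)
    (fun t u h => one_add_abs_rpow_le (by linarith) (by linarith) h)
    ((hi1.const_mul 21000).congr (Eventually.of_forall fun t => by ring))
  have hk := hj1.const_mul ((2 * x) ^ (1 / 2 + δ) * 4 * Real.exp 3)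
  refine (norm_integral_le_of_norm_le hk (Eventually.of_forall fun t => ?_)).trans ?_
  · have hs : (((1 / 2 + δ : ℝ) : ℂ) + t * I).re = 1 / 2 + δ := by
      rw [add_re, re_ofReal_mul, I_re, ofReal_re]; ring
    have hs' : (((1 / 2 + δ : ℝ) : ℂ) + t * I).im = t := by
      rw [add_im, im_ofReal_mul, I_im, ofReal_im]; ring
    have e2 := norm_cutoffTransform_sqrt_le (s := (1 / 2 + δ : ℝ) + t * I) (a := 1 / 2) hx
      (by norm_num) (by norm_num) (by norm_num; linarith) (by rw [hs]; linarith)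
    rw [hs, hs', ← hδdef] at e2
    rw [norm_mul, norm_real, Real.norm_eq_abs]
    calc _ ≤ |(deriv χ.LFunction ((1 / 2 + δ : ℝ) + t * I) /
          χ.LFunction ((1 / 2 + δ : ℝ) + t * I)).re| *
          ((2 * x) ^ (1 / 2 + δ) * (2 / (1 / 2)) * Real.exp 3 * (1 + |t|) ^ (-(1 + δ))) := by gcongr
      _ = _ := by ring
  · rw [integral_const_mul]
    have e0 : ∫ u : ℝ, (1 + |u|) ^ (-(1 + δ)) * (21000 * logConductor m u) =
        21000 * ∫ u : ℝ, (1 + |u|) ^ (-(1 + δ)) * logConductor m u := by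
      rw [← integral_const_mul]
      exact integral_congr_ae (Eventually.of_forall fun t => by ring)
    have e1 : (2 * x) ^ (1 / 2 + δ) ≤ 2 * √x * Real.exp 1 := by
      have h2 : √2 ≤ 2 := by rw [Real.sqrt_le_left] <;> norm_num
      have h3 : (2 * x) ^ δ ≤ Real.exp 1 := by
        calc (2 * x) ^ δ ≤ (x ^ 2) ^ δ := by gcongr; nlinarith
          _ = (x ^ δ) ^ 2 := by
            rw [← Real.rpow_natCast_mul hx0.le, ← Real.rpow_mul_natCast hx0.le, mul_comm]
          _ = Real.exp 1 := by rw [hδdef, rpow_shift hx, ← Real.exp_nat_mul]; norm_num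
      rw [Real.rpow_add (by positivity), ← Real.sqrt_eq_rpow, Real.sqrt_mul (by norm_num)]
      gcongr
    have e2 := log_two_mul_add_le hm hx
    rw [← hδdef] at e2
    have e4 : Real.exp 4 = Real.exp 1 * Real.exp 3 := by rw [← Real.exp_add]; norm_num
    rw [e0] at hj2
    calc _ ≤ (2 * √x * Real.exp 1 * 4 * Real.exp 3) *
          (4 * (21000 * (4 / δ * (Real.log (2 * m) + 2 / δ)))) := by
          have : 0 ≤ ∫ t : ℝ, |(deriv χ.LFunction ((1 / 2 + δ : ℝ) + t * I) /
              χ.LFunction ((1 / 2 + δ : ℝ) + t * I)).re| * (1 + |t|) ^ (-(1 + δ)) :=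
            integral_nonneg fun t => by positivity
          gcongr
          exact hj2.trans (by gcongr)
      _ = 2688000 * Real.exp 4 * √x * (1 / δ * (Real.log (2 * m) + 2 / δ)) := by
          rw [e4]; ring
      _ ≤ 2688000 * Real.exp 4 * √x * (10 * Real.log (m * x) ^ 2) := by gcongr
      _ = 26880000 * (Real.exp 4 * √x * Real.log (m * x) ^ 2) := by ring
      _ ≤ 10 ^ 8 * (Real.exp 4 * √x * Real.log (m * x) ^ 2) := by gcongr; norm_num
      _ = _ := by ring

/-- The smoothed prime number theorem for a nonprincipal character under the generalized Riemann
hypothesis. -/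
lemma norm_tsum_character_mul_vonMangoldt_mul_cutoff_le (hGRH : GRH) (hχ : χ ≠ 1) {x : ℝ}
    (hx : 2 ≤ x) :
    ‖∑' n : ℕ, χ (n : ZMod m) * (ArithmeticFunction.vonMangoldt n : ℂ) * cutoff x √x n‖ ≤
      10 ^ 9 * Real.exp 4 * √x * Real.log (m * x) ^ 2 := by
  have hm := two_le_modulus hχ
  have hδ := shift_pos hx
  have hδ' := shift_le hx
  have hx0 : 0 < x := by linarith
  have hsq : 0 < √x := Real.sqrt_pos.2 hx0
  have h1 := (hasSum_character_mul_vonMangoldt hGRH hχ (σ := 1 / 2 + shift x)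
    (by linarith : 1 ≤ x) hsq (by linarith) (by linarith)).tsum_eq
  rw [tsum_mul_left] at h1
  have h2 := norm_integral_conj_logDeriv_le hGRH hχ hx
  have h3 := integral_abs_re_logDeriv_mul_le hGRH hχ hx
  set σ := 1 / 2 + shift x with hσ
  set E : ℝ → ℂ := fun t => deriv χ.LFunction (σ + t * I) / χ.LFunction (σ + t * I) with hE
  have hW := integrable_cutoffTransform_vertical (by linarith : 1 ≤ x) hsq (c := σ) (by linarith)
  have hEc : Continuous E := continuous_logDeriv_LFunction_vertical hGRH hχ (by linarith)
  obtain ⟨C, hC⟩ := exists_norm_logDeriv_mul_cutoffTransform_le (m := m)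
    (by omega) (by linarith : 1 ≤ x) hsq (a := 1 / 2) (b := 2) (by norm_num) (by norm_num)
    (40000 / shift x) (by positivity)
  have hEb : ∀ t : ℝ, ‖E t‖ ≤ 40000 / shift x * logConductor m t := by
    intro t
    have hs : ((σ : ℂ) + t * I).re = σ := by simp
    have hs' : ((σ : ℂ) + t * I).im = t := by simp
    have := norm_logDeriv_LFunction_le_of_ge (s := σ + t * I) hGRH hχ hδ (by rw [hs])
      (by rw [hs]; linarith)
    rwa [hs'] at this
  have hint : ∀ f : ℝ → ℂ, Continuous f → (∀ t, ‖f t‖ ≤ ‖E t‖) →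
      Integrable fun t : ℝ => f t * cutoffTransform x √x (σ + t * I) := by
    intro f hf hfE
    refine ((integrable_one_add_abs_rpow (r := 3 / 2) (by norm_num)).const_mul C).mono'
      (hf.mul (continuous_cutoffTransform_vertical hx0 hsq (by linarith))).aestronglyMeasurable
      (Eventually.of_forall fun t => ?_)
    simpa using hC (σ + t * I) (f t) (by simp; linarith) (by simp; linarith) (by
      simpa using (hfE t).trans (hEb t))
  have hi1 := hint E hEc fun t => le_rfl
  have hi2 := hint (fun t => (starRingEnd ℂ) (E t)) (continuous_conj.comp hEc) fun t => by simp
  -- `E = 2 Re E - conj E`: the first part is controlled by Poisson kernels, the second by the moved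
  -- contour.
  have e1 : (∫ t : ℝ, E t * cutoffTransform x √x (σ + t * I)) =
      2 * (∫ t : ℝ, (((E t).re : ℝ) : ℂ) * cutoffTransform x √x (σ + t * I)) -
        ∫ t : ℝ, (starRingEnd ℂ) (E t) * cutoffTransform x √x (σ + t * I) := by
    rw [eq_sub_iff_add_eq, ← integral_add hi1 hi2, ← integral_const_mul]
    refine integral_congr_ae (Eventually.of_forall fun t => ?_)
    simp only
    rw [← add_mul, add_conj]
    push_cast
    ring
  rw [e1] at h1
  have h4 := congrArg norm h1
  rw [norm_neg, norm_mul] at h4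
  have h5 : ‖(2 * Real.pi : ℂ)‖ = 2 * Real.pi := by
    rw [norm_mul, norm_real, Real.norm_of_nonneg Real.pi_pos.le]; simp
  rw [h5] at h4
  have h6 := norm_sub_le
    (2 * (∫ t : ℝ, (((E t).re : ℝ) : ℂ) * cutoffTransform x √x (σ + t * I)))
    (∫ t : ℝ, (starRingEnd ℂ) (E t) * cutoffTransform x √x (σ + t * I))
  rw [norm_mul, ← h4] at h6
  simp only [RCLike.norm_ofNat] at h6
  have h7 : Real.log x ≤ 2 * √x := by
    have := Real.log_le_sub_one_of_pos hsq
    rw [Real.log_sqrt hx0.le] at this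
    linarith
  have h8 : 10 ^ 8 * Real.exp 4 * Real.log x * Real.log (m * x) ^ 2 ≤
      10 ^ 8 * Real.exp 4 * (2 * √x) * Real.log (m * x) ^ 2 := by gcongr
  have h9 : 1 * ‖∑' n : ℕ, χ (n : ZMod m) * (ArithmeticFunction.vonMangoldt n : ℂ) * cutoff x √x n‖
      ≤ 2 * Real.pi * ‖∑' n : ℕ, χ (n : ZMod m) * (ArithmeticFunction.vonMangoldt n : ℂ) *
        cutoff x √x n‖ := by
    gcongr
    linarith [Real.pi_gt_three]
  have h10 : 0 ≤ Real.exp 4 * √x * Real.log (m * x) ^ 2 := by positivity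
  linarith

end ElkiesPrimes

end

/-! ### From the smoothed sum to a sum over primes. -/

section

open Complex Filter

namespace ElkiesPrimes

/-- Abel summation against a decreasing weight. -/
lemma norm_sum_Ioc_mul_antitone_le {b : ℕ → ℂ} {w : ℕ → ℝ} {A : ℝ} {N M : ℕ} (hNM : N ≤ M)
    (hw : Antitone w) (hw0 : ∀ n, 0 ≤ w n)
    (hT : ∀ n, n ≤ M → ‖∑ k ∈ Finset.Ioc 0 n, b k‖ ≤ A) :
    ‖∑ k ∈ Finset.Ioc N M, b k * w k‖ ≤ 2 * A * w N := by
  set T : ℕ → ℂ := fun n => ∑ k ∈ Finset.Ioc 0 n, b k with hTdef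
  have hdiff : ∀ n, n ≤ M → ‖T n - T N‖ ≤ 2 * A := fun n hn =>
    (norm_sub_le _ _).trans (by linarith [hT n hn, hT N hNM])
  have hA : 0 ≤ 2 * A := (norm_nonneg _).trans (hdiff N hNM)
  -- The boundary term is carried along, so that each step adds only `2A` times the decrease of `w`
  -- and the total telescopes.
  have key : ∀ n, N ≤ n → n ≤ M →
      ‖(∑ k ∈ Finset.Ioc N n, b k * w k) - (T n - T N) * w n‖ ≤ 2 * A * (w N - w n) := by
    intro n hn
    induction n, hn using Nat.le_induction with
    | base => intro _; simp
    | succ n hn ih =>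
      intro hM
      have h1 := ih (by omega)
      have h2 := hdiff n (by omega)
      have hTs : T (n + 1) = T n + b (n + 1) := by
        simp only [hTdef]; rw [Finset.sum_Ioc_succ_top (Nat.zero_le n)]
      have hmono : 0 ≤ w n - w (n + 1) := sub_nonneg.2 (hw (Nat.le_succ n))
      rw [Finset.sum_Ioc_succ_top hn, hTs]
      have e : (∑ k ∈ Finset.Ioc N n, b k * w k) + b (n + 1) * w (n + 1) -
          (T n + b (n + 1) - T N) * w (n + 1) =
          ((∑ k ∈ Finset.Ioc N n, b k * w k) - (T n - T N) * w n) +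
            (T n - T N) * ((w n - w (n + 1) : ℝ) : ℂ) := by
        push_cast; ring
      rw [e]
      refine (norm_add_le _ _).trans ?_
      rw [norm_mul, norm_real, Real.norm_of_nonneg hmono]
      nlinarith
  have h1 := key M hNM le_rfl
  have h2 := norm_le_norm_sub_add (∑ k ∈ Finset.Ioc N M, b k * w k) ((T M - T N) * w M)
  have h3 : ‖(T M - T N) * (w M : ℂ)‖ ≤ 2 * A * w M := by
    rw [norm_mul, norm_real, Real.norm_of_nonneg (hw0 M)]
    exact mul_le_mul_of_nonneg_right (hdiff M le_rfl) (hw0 M)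
  linarith

variable {m : ℕ} [NeZero m] {χ : DirichletCharacter ℂ m}

/-- The ramp meets at most `√x + 1` integers, each contributing at most `log (2x)`. This is why the
ramp has length `√x`. -/
lemma norm_sum_character_mul_vonMangoldt_le (hGRH : GRH) (hχ : χ ≠ 1) {x : ℝ} (hx : 2 ≤ x) :
    ‖∑ n ∈ Finset.Ioc 0 ⌊x⌋₊, χ (n : ZMod m) * (ArithmeticFunction.vonMangoldt n : ℂ)‖ ≤
      10 ^ 9 * Real.exp 4 * √x * Real.log (m * x) ^ 2 + (√x + 1) * Real.log (2 * x) := by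
  have hx0 : 0 < x := by linarith
  have hsq : 0 < √x := Real.sqrt_pos.2 hx0
  have h1 := norm_tsum_character_mul_vonMangoldt_mul_cutoff_le hGRH hχ hx
  have hle : ⌊x⌋₊ ≤ ⌊x + √x⌋₊ := Nat.floor_le_floor (by linarith)
  rw [tsum_eq_sum (s := Finset.Ioc 0 ⌊x + √x⌋₊) (by
    intro n hn
    rcases Nat.eq_zero_or_pos n with rfl | hn0
    · simp
    · have h2 : ⌊x + √x⌋₊ < n := by
        by_contra h; exact hn (Finset.mem_Ioc.2 ⟨hn0, not_lt.1 h⟩)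
      rw [cutoff_of_ge hsq (Nat.lt_of_floor_lt h2).le]
      simp), ← Finset.sum_Ioc_consecutive _ (Nat.zero_le _) hle] at h1
  have e1 : ∑ n ∈ Finset.Ioc 0 ⌊x⌋₊,
      χ (n : ZMod m) * (ArithmeticFunction.vonMangoldt n : ℂ) * cutoff x √x n =
      ∑ n ∈ Finset.Ioc 0 ⌊x⌋₊, χ (n : ZMod m) * (ArithmeticFunction.vonMangoldt n : ℂ) := by
    refine Finset.sum_congr rfl fun n hn => ?_
    rw [cutoff_of_le hsq ((Nat.le_floor_iff hx0.le).1 (Finset.mem_Ioc.1 hn).2)]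
    simp
  have e2 : ‖∑ n ∈ Finset.Ioc ⌊x⌋₊ ⌊x + √x⌋₊,
      χ (n : ZMod m) * (ArithmeticFunction.vonMangoldt n : ℂ) * cutoff x √x n‖ ≤
      (√x + 1) * Real.log (2 * x) := by
    refine (norm_sum_le _ _).trans ((Finset.sum_le_card_nsmul _ _ (Real.log (2 * x)) ?_).trans ?_)
    · intro n hn
      have hn' := (Nat.le_floor_iff (by linarith)).1 (Finset.mem_Ioc.1 hn).2
      have hn0 : 0 < n := lt_of_le_of_lt (Nat.zero_le _) (Finset.mem_Ioc.1 hn).1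
      have h2 := add_sqrt_le (by linarith : 1 ≤ x)
      rw [norm_mul, norm_mul, norm_real, norm_real,
        Real.norm_of_nonneg ArithmeticFunction.vonMangoldt_nonneg,
        Real.norm_of_nonneg (cutoff_nonneg hsq _)]
      have h3 : ArithmeticFunction.vonMangoldt n ≤ Real.log (2 * x) :=
        ArithmeticFunction.vonMangoldt_le_log.trans
          (Real.log_le_log (by exact_mod_cast hn0) (by linarith))
      have h4 := χ.norm_le_one (n : ZMod m)
      have h5 := cutoff_le_one (x := x) hsq n
      have h6 := cutoff_nonneg (x := x) hsq n
      have h7 : 0 ≤ ArithmeticFunction.vonMangoldt n := ArithmeticFunction.vonMangoldt_nonneg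
      calc _ ≤ 1 * ArithmeticFunction.vonMangoldt n * 1 := by gcongr
        _ ≤ _ := by linarith
    · rw [Nat.card_Ioc, nsmul_eq_mul, Nat.cast_sub hle]
      have h2 := Nat.floor_le (by linarith : 0 ≤ x + √x)
      have h3 := Nat.lt_floor_add_one x
      have h4 : 0 ≤ Real.log (2 * x) := Real.log_nonneg (by linarith)
      gcongr
      linarith
  rw [e1] at h1
  refine (norm_le_add_norm_add _ (∑ n ∈ Finset.Ioc ⌊x⌋₊ ⌊x + √x⌋₊,
      χ (n : ZMod m) * (ArithmeticFunction.vonMangoldt n : ℂ) * cutoff x √x n)).trans ?_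
  linarith

/-- The prime number theorem for a nonprincipal character, weighted by logarithms. -/
lemma norm_sum_prime_character_mul_log_le (hGRH : GRH) (hχ : χ ≠ 1) {x : ℝ} (hx : 2 ≤ x) :
    ‖∑ n ∈ Finset.Ioc 0 ⌊x⌋₊, (if n.Prime then χ (n : ZMod m) * (Real.log n : ℂ) else 0)‖ ≤
      10 ^ 10 * Real.exp 4 * √x * Real.log (m * x) ^ 2 := by
  have hm := two_le_modulus hχ
  have hm' : (2 : ℝ) ≤ m := by exact_mod_cast hm
  have h1 := norm_sum_character_mul_vonMangoldt_le hGRH hχ hx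
  have hsplit : ∑ n ∈ Finset.Ioc 0 ⌊x⌋₊,
      (if n.Prime then χ (n : ZMod m) * (Real.log n : ℂ) else 0) =
      ∑ n ∈ Finset.Ioc 0 ⌊x⌋₊, χ (n : ZMod m) * (ArithmeticFunction.vonMangoldt n : ℂ) -
      ∑ n ∈ Finset.Ioc 0 ⌊x⌋₊ with ¬ n.Prime,
        χ (n : ZMod m) * (ArithmeticFunction.vonMangoldt n : ℂ) := by
    rw [Finset.sum_filter, ← Finset.sum_sub_distrib]
    refine Finset.sum_congr rfl fun n _ => ?_
    by_cases h : n.Prime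
    · simp [h, ArithmeticFunction.vonMangoldt_apply_prime h]
    · simp [h]
  have h2 : ‖∑ n ∈ Finset.Ioc 0 ⌊x⌋₊ with ¬ n.Prime,
      χ (n : ZMod m) * (ArithmeticFunction.vonMangoldt n : ℂ)‖ ≤ 2 * √x * Real.log x := by
    refine le_trans ?_ (Chebyshev.psi_sub_theta_le (by linarith : 1 ≤ x))
    rw [Chebyshev.psi_sub_theta_eq_sum_not_prime]
    refine (norm_sum_le _ _).trans (Finset.sum_le_sum fun n _ => ?_)
    rw [norm_mul, norm_real, Real.norm_of_nonneg ArithmeticFunction.vonMangoldt_nonneg]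
    exact mul_le_of_le_one_left ArithmeticFunction.vonMangoldt_nonneg (χ.norm_le_one _)
  have h3 : Real.log (2 * x) ≤ Real.log (m * x) := Real.log_le_log (by positivity) (by gcongr)
  have h4 : Real.log x ≤ Real.log (m * x) := Real.log_le_log (by linarith) (by nlinarith)
  have h5 : 1 ≤ Real.log (m * x) := by
    rw [Real.le_log_iff_exp_le (by positivity)]
    nlinarith [Real.exp_one_lt_d9]
  have h6 : 1 ≤ √x := by rw [Real.one_le_sqrt]; linarith
  have h7 : Real.log (m * x) ≤ Real.log (m * x) ^ 2 := by nlinarith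
  have h8 : 0 ≤ Real.log (2 * x) := Real.log_nonneg (by linarith)
  have h9 : (1 : ℝ) ≤ Real.exp 4 := Real.one_le_exp (by norm_num)
  rw [hsplit]
  refine (norm_sub_le _ _).trans ?_
  have h10 : (√x + 1) * Real.log (2 * x) ≤ (2 * √x) * Real.log (m * x) ^ 2 := by
    gcongr
    · linarith
    · linarith
  have h11 : 2 * √x * Real.log x ≤ 2 * √x * Real.log (m * x) ^ 2 := by
    gcongr; linarith
  have h12 : 4 * √x * Real.log (m * x) ^ 2 ≤ 4 * Real.exp 4 * √x * Real.log (m * x) ^ 2 := by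
    have : 0 ≤ √x * Real.log (m * x) ^ 2 := by positivity
    nlinarith
  have h13 : 0 ≤ Real.exp 4 * √x * Real.log (m * x) ^ 2 := by positivity
  linarith

/-- The prime number theorem for a nonprincipal character under the generalized Riemann
hypothesis. -/
theorem norm_sum_prime_character_le (hGRH : GRH) (hχ : χ ≠ 1) {X : ℝ} (hX : 2 ≤ X) :
    ‖∑ n ∈ Finset.Ioc 0 ⌊X⌋₊, (if n.Prime then χ (n : ZMod m) else 0)‖ ≤
      10 ^ 12 * Real.exp 4 * (√X * Real.log (m * X) ^ 2 / Real.log X) := by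
  have hm := two_le_modulus hχ
  have hm' : (2 : ℝ) ≤ m := by exact_mod_cast hm
  have hX0 : 0 < X := by linarith
  have hlX : 0 < Real.log X := Real.log_pos (by linarith)
  have hsq0 := Real.sqrt_nonneg X
  -- Up to `√X` the trivial bound suffices; beyond it the weight `1 / log n` is `O(1 / log X)`.
  set N := ⌊√X⌋₊ with hN
  have hNM : N ≤ ⌊X⌋₊ := by
    refine Nat.floor_le_floor ?_
    rw [Real.sqrt_le_left hX0.le]; nlinarith
  set b : ℕ → ℂ := fun n => if n.Prime then χ (n : ZMod m) * (Real.log n : ℂ) else 0 with hb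
  -- The maximum with `2` keeps `w` positive and antitone at `0` and `1`, without changing it at
  -- primes.
  set w : ℕ → ℝ := fun n => 1 / Real.log (max n 2 : ℕ) with hw
  have hlogpos : ∀ n : ℕ, 0 < Real.log (max n 2 : ℕ) := fun n => Real.log_pos (by
    exact_mod_cast lt_of_lt_of_le one_lt_two (le_max_right n 2))
  have hwanti : Antitone w := by
    intro a c hac
    simp only [hw]
    refine one_div_le_one_div_of_le (hlogpos a) (Real.log_le_log ?_ ?_)
    · exact_mod_cast lt_of_lt_of_le two_pos (le_max_right a 2)
    · exact_mod_cast max_le_max_right 2 hac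
  have hT : ∀ n, n ≤ ⌊X⌋₊ → ‖∑ k ∈ Finset.Ioc 0 n, b k‖ ≤
      10 ^ 10 * Real.exp 4 * √X * Real.log (m * X) ^ 2 := by
    intro n hn
    have hnX : (n : ℝ) ≤ X := (Nat.le_floor_iff hX0.le).1 hn
    rcases lt_or_ge n 2 with h | h
    · have : ∑ k ∈ Finset.Ioc 0 n, b k = 0 := by
        refine Finset.sum_eq_zero fun k hk => ?_
        have : ¬ k.Prime := fun hp => by
          have := hp.two_le; have := (Finset.mem_Ioc.1 hk).2; omega
        simp [hb, this]
      rw [this, norm_zero]; positivity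
    · have h2 : (2 : ℝ) ≤ n := by exact_mod_cast h
      have h3 := norm_sum_prime_character_mul_log_le hGRH hχ h2
      rw [Nat.floor_natCast] at h3
      refine h3.trans ?_
      have h4 : 0 ≤ Real.log (m * n) := Real.log_nonneg (by nlinarith)
      gcongr
  have h1 := norm_sum_Ioc_mul_antitone_le hNM hwanti (fun n => (one_div_pos.2 (hlogpos n)).le) hT
  have hwN : w N ≤ 4 / Real.log X := by
    simp only [hw]
    rw [div_le_div_iff₀ (hlogpos N) hlX, one_mul]
    have h2 : √X ≤ ((max N 2 : ℕ) : ℝ) ^ 2 := by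
      have h3 : √X < N + 1 := Nat.lt_floor_add_one _
      have h4 : N + 1 ≤ (max N 2) ^ 2 := by
        have := le_max_left N 2
        have := le_max_right N 2
        nlinarith
      have h5 : ((N + 1 : ℕ) : ℝ) ≤ ((max N 2) ^ 2 : ℕ) := by exact_mod_cast h4
      push_cast at h5 ⊢
      linarith
    have h3 := Real.log_le_log (Real.sqrt_pos.2 hX0) h2
    rw [Real.log_sqrt hX0.le, Real.log_pow] at h3
    push_cast at h3 ⊢
    linarith
  have hbw : ∀ k : ℕ, b k * w k = if k.Prime then χ (k : ZMod m) else 0 := by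
    intro k
    by_cases hk : k.Prime
    · simp only [hb, hw, hk, if_true, max_eq_left hk.two_le]
      have : (Real.log k : ℂ) ≠ 0 := by
        exact_mod_cast (Real.log_pos (by exact_mod_cast hk.one_lt)).ne'
      rw [ofReal_div, ofReal_one, mul_assoc, mul_one_div_cancel this, mul_one]
    · simp [hb, hk]
  simp only [hbw] at h1
  rw [← Finset.sum_Ioc_consecutive _ (Nat.zero_le N) hNM]
  have hsmall : ‖∑ n ∈ Finset.Ioc 0 N, (if n.Prime then χ (n : ZMod m) else 0)‖ ≤ √X := by
    refine (norm_sum_le _ _).trans ((Finset.sum_le_card_nsmul _ _ 1 fun n _ => ?_).trans ?_)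
    · split_ifs
      · exact χ.norm_le_one _
      · simp
    · simp only [Nat.card_Ioc, tsub_zero, nsmul_eq_mul, mul_one]
      exact Nat.floor_le hsq0
  refine (norm_add_le _ _).trans ?_
  have hL : Real.log X ≤ Real.log (m * X) ^ 2 := by
    have h4 : Real.log X ≤ Real.log (m * X) := Real.log_le_log (by linarith) (by nlinarith)
    have h5 : 1 ≤ Real.log (m * X) := by
      rw [Real.le_log_iff_exp_le (by positivity)]
      nlinarith [Real.exp_one_lt_d9]
    nlinarith
  have h2 : √X ≤ √X * Real.log (m * X) ^ 2 / Real.log X := by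
    rw [le_div_iff₀ hlX]; gcongr
  have h3 : 2 * (10 ^ 10 * Real.exp 4 * √X * Real.log (m * X) ^ 2) * w N ≤
      8 * 10 ^ 10 * Real.exp 4 * (√X * Real.log (m * X) ^ 2 / Real.log X) := by
    calc _ ≤ 2 * (10 ^ 10 * Real.exp 4 * √X * Real.log (m * X) ^ 2) * (4 / Real.log X) := by gcongr
      _ = _ := by ring
  have h9 : (1 : ℝ) ≤ Real.exp 4 := Real.one_le_exp (by norm_num)
  have h10 : 0 ≤ √X * Real.log (m * X) ^ 2 / Real.log X := by positivity
  nlinarith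

end ElkiesPrimes

end

/-! ### Nontriviality of the quadratic character of a nonsquare integer. -/

section

open NumberTheorySymbols

namespace ElkiesPrimes

lemma odd_of_coprime_four_mul {n k : ℕ} (h : n.Coprime (4 * k)) : Odd n := by
  rw [← Nat.coprime_two_right]
  exact h.coprime_mul_right_right.coprime_dvd_right (by norm_num)

/-- The Dirichlet character `n ↦ (D / n)` of modulus `4 |D|`. -/
noncomputable def jacobiCharacter (D : ℤ) : DirichletCharacter ℂ (4 * D.natAbs) where
  toFun a := open Classical in if IsUnit a then (J(D | a.val) : ℂ) else 0
  map_one' := by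
    rw [if_pos isUnit_one, ZMod.val_one_eq_one_mod]
    rw [← jacobiSym.mod_right D odd_one]
    simp
  map_mul' a b := by
    by_cases ha : IsUnit a
    · by_cases hb : IsUnit b
      · rw [if_pos (ha.mul hb), if_pos ha, if_pos hb, ZMod.val_mul]
        have ha' : Odd a.val := by
          obtain ⟨u, rfl⟩ := ha
          exact odd_of_coprime_four_mul (ZMod.val_coe_unit_coprime u)
        have hb' : Odd b.val := by
          obtain ⟨u, rfl⟩ := hb
          exact odd_of_coprime_four_mul (ZMod.val_coe_unit_coprime u)
        rw [← jacobiSym.mod_right D (ha'.mul hb'), jacobiSym.mul_right' D ha'.pos.ne' hb'.pos.ne']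
        push_cast; rfl
      · rw [if_neg hb, mul_zero, if_neg]
        exact fun h => hb (isUnit_of_mul_isUnit_right h)
    · rw [if_neg ha, zero_mul, if_neg]
      exact fun h => ha (isUnit_of_mul_isUnit_left h)
  map_nonunit' a ha := by rw [if_neg ha]

lemma jacobiCharacter_apply {D : ℤ} {n : ℕ} (h : n.Coprime (4 * D.natAbs)) :
    jacobiCharacter D (n : ZMod (4 * D.natAbs)) = (J(D | n) : ℂ) := by
  have hu : IsUnit (n : ZMod (4 * D.natAbs)) := (ZMod.isUnit_iff_coprime _ _).2 h
  change (open Classical in if IsUnit (n : ZMod (4 * D.natAbs)) then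
    (J(D | (n : ZMod (4 * D.natAbs)).val) : ℂ) else 0) = _
  rw [if_pos hu, ZMod.val_natCast, ← jacobiSym.mod_right D (odd_of_coprime_four_mul h)]

/-- Restricting to `n ≡ 1 mod 8` makes the sign and the power of two in `d` invisible. -/
lemma jacobiSym_sign_mul_pow_two {n : ℕ} (hn : n % 8 = 1) (c : ℕ) :
    J(-1 | n) = 1 ∧ J((2 : ℤ) ^ c | n) = 1 := by
  have hodd : Odd n := Nat.odd_iff.2 (by omega)
  constructor
  · rw [jacobiSym.at_neg_one hodd, ZMod.χ₄_nat_one_mod_four (by omega)]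
  · rw [jacobiSym.pow_left, jacobiSym.at_two hodd, ZMod.χ₈_nat_mod_eight, hn]
    simp

lemma exists_jacobiSym_prime_eq_neg_one {p : ℕ} (hp : p.Prime) (hp2 : p ≠ 2) :
    ∃ u : ℕ, J((u : ℤ) | p) = -1 := by
  have : Fact p.Prime := ⟨hp⟩
  obtain ⟨a, ha⟩ := FiniteField.exists_nonsquare (F := ZMod p) (by rwa [ZMod.ringChar_zmod_n])
  refine ⟨a.val, ?_⟩
  rw [ZMod.nonsquare_iff_jacobiSym_eq_neg_one]
  simpa using ha

/-- By the Chinese remainder theorem take `n ≡ 1` modulo `8 t` and `n` a nonresidue modulo `p`.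
Reciprocity, without sign as `n ≡ 1 mod 4`, leaves only the factor at `p`. -/
lemma exists_jacobiSym_nat_eq_neg_one {t p : ℕ} (hp : p.Prime) (hpt : Odd (p * t))
    (hco : p.Coprime t) : ∃ n : ℕ, n % 8 = 1 ∧ J((p * t : ℕ) | n) = -1 := by
  have hpo : Odd p := (Nat.odd_mul.1 hpt).1
  have hto : Odd t := (Nat.odd_mul.1 hpt).2
  obtain ⟨u, hu⟩ := exists_jacobiSym_prime_eq_neg_one hp (by rintro rfl; exact absurd hpo (by decide))
  have hcop : Nat.Coprime (8 * t) p := by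
    refine Nat.Coprime.mul_left ?_ hco.symm
    have : Nat.Coprime 2 p := Nat.coprime_two_left.2 hpo
    exact this.pow_left 3
  obtain ⟨n, hn1, hn2⟩ := Nat.chineseRemainder hcop 1 u
  have hn8 : n % 8 = 1 := by
    have : n ≡ 1 [MOD 8] := hn1.of_mul_right t
    exact this
  have hnt : n ≡ 1 [MOD t] := hn1.of_mul_left 8
  refine ⟨n, hn8, ?_⟩
  rw [jacobiSym.quadratic_reciprocity_one_mod_four' hpt (by omega),
    jacobiSym.mul_right' _ hpo.pos.ne' hto.pos.ne',
    jacobiSym.mod_left' (a₁ := n) (a₂ := u) (b := p) (by exact_mod_cast hn2),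
    jacobiSym.mod_left' (a₁ := n) (a₂ := 1) (b := t) (by exact_mod_cast hnt), hu,
    jacobiSym.one_left]
  norm_num

/-- A squarefree integer other than `1` has a nontrivial Jacobi symbol. -/
lemma exists_jacobiSym_eq_neg_one_of_squarefree {d : ℤ} (hd : Squarefree d) (h1 : d ≠ 1) :
    ∃ n : ℕ, Odd n ∧ J(d | n) = -1 := by
  have hd0 : d.natAbs ≠ 0 := Int.natAbs_ne_zero.2 hd.ne_zero
  obtain ⟨c, t, hto, hct⟩ := Nat.exists_eq_two_pow_mul_odd hd0
  have hsq : Squarefree d.natAbs := Int.squarefree_natAbs.2 hd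
  have htsq : Squarefree t := hsq.squarefree_of_dvd ⟨2 ^ c, by rw [hct]; ring⟩
  rcases eq_or_ne t 1 with rfl | ht1
  -- With trivial odd part, squarefreeness leaves `d = -1, 2, -2`, settled by explicit moduli.
  · have hc : c ≤ 1 := by
      by_contra! hc
      have h4 : 2 * 2 ∣ d.natAbs := by
        rw [hct, mul_one]; exact pow_dvd_pow 2 hc
      exact absurd (hsq 2 h4) (by decide)
    have hcases : d = -1 ∨ d = 2 ∨ d = -2 := by
      interval_cases c <;> omega
    rcases hcases with rfl | rfl | rfl
    · exact ⟨3, by decide, by norm_num⟩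
    · exact ⟨3, by decide, by norm_num⟩
    · exact ⟨5, by decide, by norm_num⟩
  · obtain ⟨p, hp, t', rfl⟩ := Nat.exists_prime_and_dvd ht1
    obtain ⟨n, hn8, hn⟩ := exists_jacobiSym_nat_eq_neg_one hp hto
      (Nat.squarefree_mul_iff.1 htsq).1
    obtain ⟨hs, h2⟩ := jacobiSym_sign_mul_pow_two hn8 c
    refine ⟨n, Nat.odd_iff.2 (by omega), ?_⟩
    have h3 : J((d.natAbs : ℤ) | n) = -1 := by
      rw [hct]
      push_cast
      rw [jacobiSym.mul_left, h2, one_mul]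
      exact_mod_cast hn
    rcases Int.natAbs_eq d with h | h
    · rw [h]; exact h3
    · rw [h, neg_eq_neg_one_mul, jacobiSym.mul_left, hs, h3]; norm_num

/-- A nonsquare integer is a quadratic nonresidue modulo some prime. -/
lemma exists_prime_jacobiSym_eq_neg_one {D : ℤ} (hD : ¬ IsSquare D) :
    ∃ l : ℕ, l.Coprime (4 * D.natAbs) ∧ J(D | l) = -1 := by
  have hD0 : D ≠ 0 := by rintro rfl; exact hD ⟨0, by simp⟩
  have hDn : D.natAbs ≠ 0 := Int.natAbs_ne_zero.2 hD0
  obtain ⟨s, r, hsr, hs⟩ := Nat.sq_mul_squarefree D.natAbs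
  have hr0 : r ≠ 0 := by
    rintro rfl; apply hDn; rw [← hsr]; simp
  set d : ℤ := D.sign * s with hd
  have hDd : D = d * (r : ℤ) ^ 2 := by
    have h1 := Int.sign_mul_natAbs D
    have h2 : (D.natAbs : ℤ) = r ^ 2 * s := by exact_mod_cast hsr.symm
    rw [h2] at h1
    rw [hd, mul_assoc, mul_comm (s : ℤ), h1]
  have hdn : d.natAbs = s := by
    rw [hd, Int.natAbs_mul, Int.natAbs_sign_of_ne_zero hD0]; simp
  have hdsq : Squarefree d := Int.squarefree_natAbs.1 (by rwa [hdn])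
  have hd1 : d ≠ 1 := by
    intro h; apply hD; rw [hDd, h]; exact ⟨r, by ring⟩
  obtain ⟨n, hn, hJ⟩ := exists_jacobiSym_eq_neg_one_of_squarefree hdsq hd1
  have hs0 : s ≠ 0 := hs.ne_zero
  have hgcd : n.Coprime (4 * s) := by
    refine Nat.Coprime.mul_right ?_ ?_
    · exact (Nat.coprime_two_right.2 hn).pow_right 2
    · by_contra h
      have : J(d | n) = 0 := jacobiSym.eq_zero_iff.2 ⟨hn.pos.ne', by
        rwa [Int.gcd, hdn, Int.natAbs_natCast, Nat.gcd_comm]⟩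
      rw [this] at hJ; norm_num at hJ
  have : NeZero (4 * s) := ⟨by positivity⟩
  -- The modulus `n` found for the squarefree part `d` may share factors with `r`, where `D = d r²`.
  -- Dirichlet's theorem replaces it by a prime in the same class modulo `4 s`, large enough to be
  -- coprime to `D` and `r`.
  obtain ⟨l, hlD, hl, hln⟩ := Nat.forall_exists_prime_gt_and_eq_mod
    ((ZMod.isUnit_iff_coprime n (4 * s)).2 hgcd) (4 * D.natAbs)
  have hcop : ∀ k : ℕ, k ≠ 0 → k < l → l.Coprime k := fun k hk hkl =>
    (Nat.Prime.coprime_iff_not_dvd hl).2 fun h => absurd (Nat.le_of_dvd (by omega) h) (by omega)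
  have hrl : r ≤ D.natAbs := by
    rw [← hsr]
    have : 1 ≤ s := Nat.one_le_iff_ne_zero.2 hs0
    have : 1 ≤ r := Nat.one_le_iff_ne_zero.2 hr0
    nlinarith
  refine ⟨l, hcop _ (by omega) hlD, ?_⟩
  have hlodd : Odd l := hl.odd_of_ne_two (by omega)
  have hmod : l % (4 * d.natAbs) = n % (4 * d.natAbs) := by
    rw [hdn]; exact (ZMod.natCast_eq_natCast_iff' l n (4 * s)).1 hln
  rw [hDd, jacobiSym.mul_left, jacobiSym.mod_right d hlodd, hmod, ← jacobiSym.mod_right d hn, hJ,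
    jacobiSym.sq_one', mul_one]
  rw [Int.gcd_comm]
  exact hcop r hr0 (by omega)

lemma jacobiCharacter_ne_one {D : ℤ} (hD : ¬ IsSquare D) : jacobiCharacter D ≠ 1 := by
  obtain ⟨l, hl, hJ⟩ := exists_prime_jacobiSym_eq_neg_one hD
  intro h
  have h1 := jacobiCharacter_apply hl
  rw [h, hJ, MulChar.one_apply ((ZMod.isUnit_iff_coprime _ _).2 hl)] at h1
  norm_num at h1

end ElkiesPrimes

end

/-! ### Counting Elkies primes. -/

section

open Filter Asymptotics NumberTheorySymbols

namespace ElkiesPrimes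

lemma two_pow_card_primeFactors_le {n : ℕ} (hn : n ≠ 0) : 2 ^ n.primeFactors.card ≤ n := by
  calc 2 ^ n.primeFactors.card ≤ ∏ p ∈ n.primeFactors, p :=
        Finset.pow_card_le_prod _ _ _ fun p hp => (Nat.prime_of_mem_primeFactors hp).two_le
    _ ≤ n := Nat.le_of_dvd (Nat.pos_of_ne_zero hn) (Nat.prod_primeFactors_dvd n)

lemma card_primeFactors_le_log {n : ℕ} (hn : n ≠ 0) :
    (n.primeFactors.card : ℝ) ≤ 2 * Real.log n := by
  have h1 : ((2 : ℝ) ^ n.primeFactors.card) ≤ n := by exact_mod_cast two_pow_card_primeFactors_le hn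
  have h2 := Real.log_le_log (by positivity) h1
  rw [Real.log_pow] at h2
  nlinarith [Real.log_two_gt_d9, (Nat.cast_nonneg n.primeFactors.card : (0 : ℝ) ≤ _)]

section Curve

variable {F : Type*} [Field F] (E : WeierstrassCurve F)

lemma isElkiesPrime_iff {p : ℕ} (hp : p.Prime)
    (h : ¬ p ∣ 4 * (frobDisc E).natAbs * Nat.card F) :
    IsElkiesPrime E p ↔ J(frobDisc E | p) = 1 := by
  have : Fact p.Prime := ⟨hp⟩
  have h2 : p ≠ 2 := by
    rintro rfl
    exact h (Dvd.dvd.mul_right (Dvd.dvd.mul_right (by norm_num) _) _)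
  have hq : p.Coprime (Nat.card F) :=
    (Nat.Prime.coprime_iff_not_dvd hp).2 fun h' => h (h'.mul_left _)
  constructor
  · rintro ⟨_, _, hs⟩
    rwa [symbol, if_neg h2, jacobiSym.legendreSym.to_jacobiSym] at hs
  · intro hs
    refine ⟨hp, hq, ?_⟩
    rwa [symbol, if_neg h2, jacobiSym.legendreSym.to_jacobiSym]

-- Off the exceptional primes the symbol is `±1` and the difference vanishes. An exceptional prime,
-- in particular `2`, costs at most `1`, so the value of the symbol there is irrelevant.
open Classical in
lemma abs_indicator_sub_character_le {p : ℕ} (hp : p.Prime) :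
    |(if IsElkiesPrime E p then (1 : ℝ) else 0) - 1 / 2 -
        (jacobiCharacter (frobDisc E) (p : ZMod (4 * (frobDisc E).natAbs))).re / 2| ≤
      if p ∣ 4 * (frobDisc E).natAbs * Nat.card F then 1 else 0 := by
  by_cases h : p ∣ 4 * (frobDisc E).natAbs * Nat.card F
  · rw [if_pos h]
    have h1 := (Complex.abs_re_le_norm _).trans ((jacobiCharacter (frobDisc E)).norm_le_one
      (p : ZMod (4 * (frobDisc E).natAbs)))
    rw [abs_le] at h1 ⊢
    split_ifs <;> constructor <;> linarith
  · rw [if_neg h]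
    have hco : p.Coprime (4 * (frobDisc E).natAbs) :=
      (Nat.Prime.coprime_iff_not_dvd hp).2 fun h' => h (h'.mul_right _)
    rw [jacobiCharacter_apply hco, isElkiesPrime_iff E hp h]
    have hg : (frobDisc E).gcd p = 1 := by
      rw [Int.gcd_comm]
      exact hco.coprime_mul_left_right
    rcases jacobiSym.eq_one_or_neg_one hg with h1 | h1 <;> rw [h1] <;> norm_num

lemma elkiesCount_floor (X : ℝ) : elkiesCount E (⌊X⌋₊ : ℕ) = elkiesCount E X := by
  rw [elkiesCount, elkiesCount, Nat.floor_natCast]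

variable [Finite F]

lemma card_point_le : Nat.card E.toAffine.Point ≤ Nat.card F ^ 2 + 1 := by
  let f : E.toAffine.Point → Option (F × F)
    | .zero => none
    | .some x y _ => some (x, y)
  have hf : Function.Injective f := by
    rintro (_ | ⟨x, y, h⟩) (_ | ⟨x', y', h'⟩) hxy <;> simp_all [f]
  calc Nat.card E.toAffine.Point ≤ Nat.card (Option (F × F)) := Nat.card_le_card_of_injective f hf
    _ = _ := by rw [Finite.card_option, Nat.card_prod, sq]

/-- Only `log |D|` enters the error term, so the trivial count of points suffices and Hasse's bound
is not needed. -/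
lemma natAbs_frobDisc_le : (frobDisc E).natAbs ≤ Nat.card F ^ 5 := by
  have hq : 2 ≤ Nat.card F := Finite.one_lt_card
  have hP := card_point_le E
  zify
  rw [frobDisc, trace]
  set q : ℤ := (Nat.card F : ℤ) with hqd
  set P : ℤ := (Nat.card E.toAffine.Point : ℤ) with hPd
  have hq' : 2 ≤ q := by rw [hqd]; exact_mod_cast hq
  have hP' : P ≤ q ^ 2 + 1 := by rw [hPd, hqd]; exact_mod_cast hP
  have hP0 : 0 ≤ P := by positivity
  have ht : |q + 1 - P| ≤ q ^ 2 := by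
    rw [abs_le]; constructor <;> nlinarith
  have ht2 : (q + 1 - P) ^ 2 ≤ q ^ 4 := by
    calc (q + 1 - P) ^ 2 = |q + 1 - P| ^ 2 := (sq_abs _).symm
      _ ≤ (q ^ 2) ^ 2 := by gcongr
      _ = q ^ 4 := by ring
  have h3 : 4 * q ≤ q ^ 4 := by nlinarith [pow_le_pow_left₀ (by norm_num) hq' 3]
  have h5 : 2 * q ^ 4 ≤ q ^ 5 := by
    rw [pow_succ q 4, mul_comm]; gcongr
  have h6 := sq_nonneg (q + 1 - P)
  rw [abs_le]; constructor <;> linarith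

lemma abs_elkiesCount_sub_le (hD : frobDisc E ≠ 0) (N : ℕ) :
    |(elkiesCount E N : ℝ) - (Nat.primeCounting N : ℝ) / 2 - (∑ n ∈ Finset.Ioc 0 N,
        (if n.Prime then jacobiCharacter (frobDisc E) (n : ZMod (4 * (frobDisc E).natAbs))
          else 0)).re / 2| ≤
      (4 * (frobDisc E).natAbs * Nat.card F).primeFactors.card := by
  classical
  set S := (Finset.Ioc 0 N).filter Nat.Prime with hS
  have hSr : (Finset.range (N + 1)).filter Nat.Prime = S := by
    ext p
    simp only [hS, Finset.mem_filter, Finset.mem_range, Finset.mem_Ioc]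
    exact ⟨fun h => ⟨⟨h.2.pos, by omega⟩, h.2⟩, fun h => ⟨by omega, h.2⟩⟩
  have h1 : (Nat.primeCounting N : ℝ) = ∑ p ∈ S, 1 := by
    rw [Nat.primeCounting, Nat.primeCounting', Nat.count_eq_card_filter_range, hSr]
    simp
  have h2 : (elkiesCount E N : ℝ) = ∑ p ∈ S, if IsElkiesPrime E p then 1 else 0 := by
    rw [elkiesCount, Nat.floor_natCast, Finset.sum_boole, ← hSr, Finset.filter_filter]
    congr 2
    ext p
    simp only [Finset.mem_filter, Finset.mem_range]
    exact ⟨fun h => ⟨h.1, h.2.1, h.2⟩, fun h => ⟨h.1, h.2.2⟩⟩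
  have h3 : (∑ n ∈ Finset.Ioc 0 N, (if n.Prime then
      jacobiCharacter (frobDisc E) (n : ZMod (4 * (frobDisc E).natAbs)) else 0)) =
      ∑ n ∈ S, jacobiCharacter (frobDisc E) (n : ZMod (4 * (frobDisc E).natAbs)) :=
    (Finset.sum_filter _ _).symm
  rw [h1, h2, h3, Complex.re_sum, Finset.sum_div, Finset.sum_div,
    ← Finset.sum_sub_distrib, ← Finset.sum_sub_distrib]
  refine (Finset.abs_sum_le_sum_abs _ _).trans ?_
  refine (Finset.sum_le_sum fun p hp =>
    abs_indicator_sub_character_le E (Finset.mem_filter.1 hp).2).trans ?_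
  rw [Finset.sum_boole]
  have hne : 4 * (frobDisc E).natAbs * Nat.card F ≠ 0 := by
    have := Int.natAbs_ne_zero.2 hD
    have := (Nat.card_pos (α := F)).ne'
    positivity
  exact_mod_cast Finset.card_le_card fun p hp => by
    rw [Finset.mem_filter, Finset.mem_filter] at hp
    exact Nat.mem_primeFactors.2 ⟨hp.1.2, hp.2, hne⟩

theorem abs_elkiesCount_sub_half_primeCounting_le (hGRH : GRH) (hD : ¬ IsSquare (frobDisc E))
    {X : ℝ} (hX : 2 ≤ X) :
    |(elkiesCount E X : ℝ) - (Nat.primeCounting ⌊X⌋₊ : ℝ) / 2| ≤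
      (10 ^ 14 * Real.exp 4) * (√X * Real.log ((Nat.card F : ℝ) * X) ^ 2 / Real.log X) := by
  have hD0 : frobDisc E ≠ 0 := fun h => hD (h ▸ ⟨0, by simp⟩)
  have hDn : (frobDisc E).natAbs ≠ 0 := Int.natAbs_ne_zero.2 hD0
  have : NeZero (4 * (frobDisc E).natAbs) := ⟨by positivity⟩
  have h1 := abs_elkiesCount_sub_le E hD0 ⌊X⌋₊
  have h2 := norm_sum_prime_character_le hGRH (jacobiCharacter_ne_one hD) hX
  rw [elkiesCount_floor] at h1
  set T := ∑ n ∈ Finset.Ioc 0 ⌊X⌋₊, (if n.Prime then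
    jacobiCharacter (frobDisc E) (n : ZMod (4 * (frobDisc E).natAbs)) else 0)
  have hq : 2 ≤ Nat.card F := Finite.one_lt_card
  have hm : 4 * (frobDisc E).natAbs ≤ Nat.card F ^ 7 := by
    calc 4 * (frobDisc E).natAbs ≤ Nat.card F ^ 2 * Nat.card F ^ 5 := by
          gcongr
          · nlinarith
          · exact natAbs_frobDisc_le E
      _ = _ := by ring
  have hmq : 4 * (frobDisc E).natAbs * Nat.card F ≤ Nat.card F ^ 8 := by
    rw [pow_succ]; gcongr
  have hne : 4 * (frobDisc E).natAbs * Nat.card F ≠ 0 := by positivity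
  have h3 := card_primeFactors_le_log hne
  set m := 4 * (frobDisc E).natAbs
  have hmpos : 0 < m := NeZero.pos m
  set q := Nat.card F
  have hqR : (2 : ℝ) ≤ q := by exact_mod_cast hq
  have hX0 : 0 < X := by linarith
  have hlX : 0 < Real.log X := Real.log_pos (by linarith)
  set L := Real.log (q * X) with hL
  have hLq : L = Real.log q + Real.log X := Real.log_mul (by positivity) hX0.ne'
  have hlq : Real.log 2 ≤ Real.log q := Real.log_le_log (by norm_num) hqR
  have hl2X : Real.log 2 ≤ Real.log X := Real.log_le_log (by norm_num) hX
  have hl2 := Real.log_two_gt_d9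
  have hL1 : 1 ≤ L := by linarith
  have hmR : (m : ℝ) ≤ (q : ℝ) ^ 7 := by exact_mod_cast hm
  have hmqR : ((m * q : ℕ) : ℝ) ≤ (q : ℝ) ^ 8 := by exact_mod_cast hmq
  have h4 : Real.log (m * X) ≤ 7 * L := by
    rw [Real.log_mul (by exact_mod_cast hmpos.ne') hX0.ne']
    have := Real.log_le_log (by exact_mod_cast hmpos) hmR
    rw [Real.log_pow] at this
    push_cast at this
    linarith
  have h4' : 0 ≤ Real.log (m * X) := Real.log_nonneg (by
    have : (1 : ℝ) ≤ m := by exact_mod_cast hmpos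
    nlinarith)
  have h5 : Real.log (m * q : ℕ) ≤ 8 * L := by
    have := Real.log_le_log (by exact_mod_cast Nat.pos_of_ne_zero hne) hmqR
    rw [Real.log_pow] at this
    push_cast at this ⊢
    linarith
  have h6 : Real.log X ≤ 2 * √X := by
    have := Real.log_le_self (Real.sqrt_nonneg X)
    rw [Real.log_sqrt hX0.le] at this
    linarith
  -- Absorbs the `O(log q)` exceptional primes into the error term, even when `X` is small compared
  -- with `q`.
  have h7 : L ≤ 2 * (√X * L ^ 2 / Real.log X) := by
    rw [← mul_div_assoc, le_div_iff₀ hlX]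
    calc L * Real.log X ≤ L * (2 * √X) := by gcongr
      _ ≤ L * L * (2 * √X) := by gcongr; nlinarith
      _ = _ := by ring
  have h8 : √X * Real.log (m * X) ^ 2 / Real.log X ≤ 49 * (√X * L ^ 2 / Real.log X) := by
    calc _ ≤ √X * (7 * L) ^ 2 / Real.log X := by gcongr
      _ = _ := by ring
  set B := √X * L ^ 2 / Real.log X
  have h9 : |T.re| ≤ 10 ^ 12 * Real.exp 4 * (49 * B) :=
    (Complex.abs_re_le_norm T).trans (h2.trans (by gcongr))
  have h10 : (1 : ℝ) ≤ Real.exp 4 := Real.one_le_exp (by norm_num)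
  have hB : 0 ≤ B := by positivity
  have h11 : B ≤ Real.exp 4 * B := le_mul_of_one_le_left hB h10
  rw [abs_le] at h1 h9 ⊢
  constructor <;> nlinarith

end Curve

lemma isLittleO_sqrt_mul_log_sq_div_log (q : ℝ) (hq : 0 < q) :
    (fun X : ℝ => √X * Real.log (q * X) ^ 2 / Real.log X) =o[atTop]
      fun X : ℝ => X / Real.log X := by
  have h1 : (fun X : ℝ => Real.log (q * X)) =o[atTop] fun X : ℝ => X ^ (1 / 4 : ℝ) := by
    have h2 : (fun X : ℝ => Real.log q + Real.log X) =o[atTop] fun X : ℝ => X ^ (1 / 4 : ℝ) := by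
      refine IsLittleO.add ?_ (isLittleO_log_rpow_atTop (by norm_num))
      rw [isLittleO_const_left]
      right
      exact tendsto_norm_atTop_atTop.comp (tendsto_rpow_atTop (by norm_num))
    refine h2.congr' ?_ EventuallyEq.rfl
    filter_upwards [eventually_gt_atTop 0] with X hX
    rw [Real.log_mul hq.ne' hX.ne']
  have h2 := ((isBigO_refl (fun X : ℝ => √X / Real.log X) atTop).mul_isLittleO (h1.pow two_pos))
  refine h2.congr' ?_ ?_
  · filter_upwards with X
    ring
  · filter_upwards [eventually_gt_atTop 0] with X hX
    rw [← Real.rpow_natCast, ← Real.rpow_mul hX.le,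
      show (1 / 4 : ℝ) * (2 : ℕ) = 1 / 2 by norm_num, ← Real.sqrt_eq_rpow, div_mul_eq_mul_div,
      Real.mul_self_sqrt hX.le]

/-- Chebyshev's lower bound for `π` is enough here, because the error term is already `o(X / log
X)`. -/
lemma isBigO_div_log_primeCounting :
    (fun X : ℝ => X / Real.log X) =O[atTop] fun X : ℝ => (Nat.primeCounting ⌊X⌋₊ : ℝ) / 2 := by
  have hlog : (fun X : ℝ => Real.log X) =o[atTop] fun X : ℝ => X := Real.isLittleO_log_id_atTop
  refine IsBigO.of_bound 8 ?_
  filter_upwards [hlog.bound (show (0 : ℝ) < 1 / 16 by norm_num), eventually_ge_atTop 32]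
    with X hX hX32
  have hlX : 0 < Real.log X := Real.log_pos (by linarith)
  rw [Real.norm_of_nonneg hlX.le, Real.norm_of_nonneg (by linarith)] at hX
  rw [Real.norm_of_nonneg (by positivity), Real.norm_of_nonneg (by positivity)]
  have h1 := Chebyshev.pi_ge' (x := X) (by linarith)
  have h2 : Real.log (X + 2) ≤ 2 * Real.log X := by
    rw [← Real.log_rpow (by linarith)]
    refine Real.log_le_log (by linarith) ?_
    norm_num
    nlinarith
  have h3 : X / Real.log X ≤ 4 * (((X - 1) * Real.log 2 - Real.log (X + 2)) / Real.log X) := by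
    rw [← mul_div_assoc]
    gcongr
    nlinarith [Real.log_two_gt_d9]
  linarith

end ElkiesPrimes

end

theorem theorem2 (hGRH : ElkiesPrimes.GRH) :
    (∃ C : ℝ, ∀ (F : Type*) [Field F] [Finite F] (E : WeierstrassCurve F) [E.IsElliptic],
      ¬ IsSquare (ElkiesPrimes.frobDisc E) →
      ∀ X : ℝ, 2 ≤ X →
        |(ElkiesPrimes.elkiesCount E X : ℝ) - (Nat.primeCounting ⌊X⌋₊ : ℝ) / 2| ≤
          C * (Real.sqrt X * Real.log ((Nat.card F : ℝ) * X) ^ 2 / Real.log X)) ∧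
    (∀ (F : Type*) [Field F] [Finite F] (E : WeierstrassCurve F) [E.IsElliptic],
      ¬ IsSquare (ElkiesPrimes.frobDisc E) →
      Asymptotics.IsEquivalent Filter.atTop
        (fun X : ℝ => (ElkiesPrimes.elkiesCount E X : ℝ))
        (fun X : ℝ => (Nat.primeCounting ⌊X⌋₊ : ℝ) / 2)) := by
  refine ⟨⟨10 ^ 14 * Real.exp 4, fun F _ _ E _ hD X hX =>
    ElkiesPrimes.abs_elkiesCount_sub_half_primeCounting_le E hGRH hD hX⟩, fun F _ _ E _ hD => ?_⟩
  have hq : (0 : ℝ) < Nat.card F := by exact_mod_cast Nat.card_pos (α := F)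
  refine Asymptotics.IsBigO.trans_isLittleO ?_
    ((ElkiesPrimes.isLittleO_sqrt_mul_log_sq_div_log (Nat.card F) hq).trans_isBigO
      ElkiesPrimes.isBigO_div_log_primeCounting)
  refine Asymptotics.IsBigO.of_bound (10 ^ 14 * Real.exp 4) ?_
  filter_upwards [Filter.eventually_ge_atTop 2] with X hX
  have h := ElkiesPrimes.abs_elkiesCount_sub_half_primeCounting_le E hGRH hD hX
  exact h.trans (mul_le_mul_of_nonneg_left (Real.le_norm_self _) (by positivity))
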